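/- Let $B$ be a $C^*$-algebra and let $A\subseteq B$ be a maximal abelian $C^*$-subalgebra (masa) such that the inclusion is regular, i.e. the set of normalisers $N(A,B)=\{n\in B: n^*An\subseteq A,\ nAn^*\subseteq A\}$ spans a dense subspace of $B$. Then: 1. The inclusion $A\subseteq B$ is aperiodic: for every $\varepsilon>0$, every non-zero hereditary $C^*$-subalgebra $D\subseteq A$ and every $x\in B/A$ there is $a\in D$ with $a\geq 0$, $\|a\|=1$ and $\|axa\|<\varepsilon$ in the quotient norm of the Banach $A$-bimodule $B/A$. 2. There is at most one local expectation $E\colon B\to M_{\mathrm{loc}}(A)$. Here $M_{\mathrm{loc}}(A)=\varinjlim_I M(I)$ is the local multiplier algebra, the $C^*$-algebraic direct limit of the multiplier algebras of the essential closed ideals $I$ of $A$ along the restriction maps, and a local expectation is a completely positive contractive linear map $E$ whose restriction to $A$ is the canonical embedding $A\subseteq M_{\mathrm{loc}}(A)$. 3. If $E$ is a local expectation, then $E(W)\subseteq M(W\cap A)$ for every slice $W\subseteq B$, that is, for every closed linear subspace $W\subseteq N(A,B)$ with $AW+WA\subseteq W$ and $W^*W+WW^*\subseteq A$. Here $W\cap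 A$ is a closed ideal of $A$ and, for a closed ideal $J$ of $A$ with annihilator $J^\perp$, $M(J)$ is regarded as a subalgebra of $M_{\mathrm{loc}}(A)$ by extending multipliers of $J$ by zero to the essential ideal $J\oplus J^\perp$. -/

import Mathlib

noncomputable section

open scoped MultiplierAlgebra
open Filter Topology

/-- A closed two-sided ideal of a C⋆-algebra. -/
structure ClosedIdeal (A : Type*) [NonUnitalCStarAlgebra A] extends Submodule ℂ A where
  isClosed' : IsClosed carrier
  mul_mem_left' : ∀ (a : A) {x : A}, x ∈ carrier → a * x ∈ carrier
  mul_mem_right' : ∀ (a : A) {x : A}, x ∈ carrier → x * a ∈ carrier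

namespace ClosedIdeal

variable {A : Type*} [NonUnitalCStarAlgebra A]

instance : SetLike (ClosedIdeal A) A where
  coe I := I.carrier
  coe_injective I J h := by
    obtain ⟨I, _, _, _⟩ := I
    obtain ⟨J, _, _, _⟩ := J
    congr
    exact SetLike.coe_injective h

instance : PartialOrder (ClosedIdeal A) := .ofSetLike (ClosedIdeal A) A

theorem mul_mem_left (I : ClosedIdeal A) (a : A) {x : A} (hx : x ∈ I) : a * x ∈ I :=
  I.mul_mem_left' a hx

theorem mul_mem_right (I : ClosedIdeal A) (a : A) {x : A} (hx : x ∈ I) : x * a ∈ I :=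
  I.mul_mem_right' a hx

instance isClosed (I : ClosedIdeal A) : IsClosed (I : Set A) := I.isClosed'

instance : NonUnitalSubringClass (ClosedIdeal A) A where
  add_mem {I} _ _ ha hb := I.add_mem ha hb
  zero_mem I := I.zero_mem
  neg_mem {I} _ ha := I.toSubmodule.neg_mem ha
  mul_mem {I} a _ _ hb := I.mul_mem_left a hb

instance : SMulMemClass (ClosedIdeal A) ℂ A where
  smul_mem {I} c _ ha := I.smul_mem c ha

/-- Closed two-sided ideals of C⋆-algebras are self-adjoint. -/
theorem star_mem' (I : ClosedIdeal A) {a : A} (ha : a ∈ I) : star a ∈ I := by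
  let N : NonUnitalStarSubalgebra ℂ A :=
    { carrier := {x | x ∈ I ∧ star x ∈ I}
      add_mem' := fun {x y} hx hy => ⟨add_mem hx.1 hy.1, by
        rw [star_add]; exact add_mem hx.2 hy.2⟩
      zero_mem' := ⟨zero_mem I, by rw [star_zero]; exact zero_mem I⟩
      mul_mem' := fun {x y} hx hy => ⟨mul_mem hx.1 hy.1, by
        rw [star_mul]; exact mul_mem hy.2 hx.2⟩
      smul_mem' := fun c x hx => ⟨SMulMemClass.smul_mem c hx.1, by
        rw [star_smul]; exact SMulMemClass.smul_mem _ hx.2⟩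
      star_mem' := fun {x} hx => ⟨hx.2, by rw [star_star]; exact hx.1⟩ }
  have : IsClosed (N : Set A) :=
    I.isClosed.inter (I.isClosed.preimage continuous_star)
  let _ : PartialOrder N := CStarAlgebra.spectralOrder N
  have : StarOrderedRing N := CStarAlgebra.spectralOrderedRing N
  have hl := CStarAlgebra.increasingApproximateUnit N
  let l := CStarAlgebra.approximateUnit N
  have : l.NeBot := hl.neBot
  have hp : a * star a ∈ N :=
    ⟨I.mul_mem_right _ ha, by rw [star_mul, star_star]; exact I.mul_mem_right _ ha⟩
  set p : N := ⟨a * star a, hp⟩ with hpdef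
  have hR : Tendsto (fun e : N => p - p * e) l (𝓝 0) := by
    simpa using (tendsto_const_nhds (x := p)).sub (hl.tendsto_mul_left p)
  have hbd : ∀ᶠ e : N in l, ‖star a - star a * (e : A)‖ ^ 2 ≤ 2 * ‖p - p * e‖ := by
    filter_upwards [hl.eventually_norm, hl.eventually_star_eq] with e he hes
    have h1 : ‖star a - star a * (e : A)‖ ^ 2
        = ‖star (star a - star a * (e : A)) * (star a - star a * (e : A))‖ := by
      rw [CStarRing.norm_star_mul_self, sq]
    have hes' : star (e : A) = e := congrArg Subtype.val hes
    have h2 : star (star a - star a * (e : A)) * (star a - star a * (e : A))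
        = ((p - p * e - e * (p - p * e) : N) : A) := by
      simp only [star_sub, star_mul, star_star, hes', hpdef]
      push_cast
      noncomm_ring
    rw [h1, h2]
    calc ‖((p - p * e - e * (p - p * e) : N) : A)‖ = ‖p - p * e - e * (p - p * e)‖ := rfl
      _ ≤ ‖p - p * e‖ + ‖e * (p - p * e)‖ := norm_sub_le _ _
      _ ≤ ‖p - p * e‖ + 1 * ‖p - p * e‖ := by
          gcongr
          exact (norm_mul_le _ _).trans (by gcongr)
      _ = 2 * ‖p - p * e‖ := by ring
  have h0 : Tendsto (fun e : N => ‖star a - star a * (e : A)‖ ^ 2) l (𝓝 0) :=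
    squeeze_zero' (.of_forall fun _ => by positivity) hbd (by simpa using hR.norm.const_mul 2)
  have h1 : Tendsto (fun e : N => ‖star a - star a * (e : A)‖) l (𝓝 0) := by
    simpa using h0.sqrt
  have h2 : Tendsto (fun e : N => star a * (e : A)) l (𝓝 (star a)) := by
    rw [tendsto_iff_norm_sub_tendsto_zero]
    simpa [norm_sub_rev] using h1
  exact I.isClosed.mem_of_tendsto h2 (.of_forall fun e => I.mul_mem_left _ e.2.1)

instance : StarMemClass (ClosedIdeal A) A where
  star_mem {I} _ ha := I.star_mem' ha


section Multiplier

variable {I J K : ClosedIdeal A}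

theorem fst_mul (m : 𝓜(ℂ, I)) (x y : I) : m.fst (x * y) = m.fst x * y := by
  have h : ∀ z : I, z * (m.fst (x * y) - m.fst x * y) = 0 := fun z => by
    rw [mul_sub, ← m.central, ← mul_assoc, ← mul_assoc, ← m.central, sub_self]
  exact sub_eq_zero.1 (CStarRing.star_mul_self_eq_zero_iff _ |>.1 (h _))

theorem snd_mul (m : 𝓜(ℂ, I)) (x y : I) : m.snd (x * y) = x * m.snd y := by
  have h : ∀ z : I, (m.snd (x * y) - x * m.snd y) * z = 0 := fun z => by
    rw [sub_mul, m.central, mul_assoc, mul_assoc, m.central, sub_self]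
  exact sub_eq_zero.1 (CStarRing.mul_star_self_eq_zero_iff _ |>.1 (h _))

/-- The inclusion of a smaller ideal into a larger one. -/
def incl (h : J ≤ I) (x : J) : I := ⟨x, h x.2⟩

/-- A multiplier of `I` maps every closed ideal `J ⊆ I` into itself. -/
theorem fst_mem (h : J ≤ I) (m : 𝓜(ℂ, I)) (x : J) : (m.fst (incl h x) : A) ∈ J := by
  let _ : PartialOrder J := CStarAlgebra.spectralOrder J
  have : StarOrderedRing J := CStarAlgebra.spectralOrderedRing J
  have hl := CStarAlgebra.increasingApproximateUnit J
  have := hl.neBot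
  have hc : Continuous fun y : J => (m.fst (incl h y) : A) :=
    continuous_subtype_val.comp
      (m.fst.continuous.comp (continuous_subtype_val.subtype_mk _))
  refine J.isClosed.mem_of_tendsto ((hc.tendsto x).comp (hl.tendsto_mul_left x))
    (.of_forall fun e => ?_)
  have : m.fst (incl h (x * e)) = m.fst (incl h x) * incl h e := fst_mul m (incl h x) (incl h e)
  simp only [Function.comp, this]
  exact J.mul_mem_left _ e.2

theorem snd_mem (h : J ≤ I) (m : 𝓜(ℂ, I)) (x : J) : (m.snd (incl h x) : A) ∈ J := by
  have := J.star_mem' (fst_mem h (star m) (star x))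
  rw [DoubleCentralizer.star_fst] at this
  have h2 : star (incl h (star x)) = incl h x := Subtype.ext (star_star (x : A))
  rw [h2] at this
  simpa using this

/-- Restriction of multipliers `M(I) → M(J)` for closed ideals `J ⊆ I`. -/
def restrict (h : J ≤ I) : 𝓜(ℂ, I) →⋆ₐ[ℂ] 𝓜(ℂ, J) where
  toFun m :=
    { fst :=
        { toFun := fun x => ⟨m.fst (incl h x), fst_mem h m x⟩
          map_add' := fun x y => Subtype.ext <| congrArg (Subtype.val (p := (· ∈ I)))
            (map_add m.fst (incl h x) (incl h y))
          map_smul' := fun c x => Subtype.ext <| congrArg (Subtype.val (p := (· ∈ I)))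
            (map_smul m.fst c (incl h x))
          cont := (continuous_subtype_val.comp
            (m.fst.continuous.comp (continuous_subtype_val.subtype_mk _))).subtype_mk _ }
      snd :=
        { toFun := fun x => ⟨m.snd (incl h x), snd_mem h m x⟩
          map_add' := fun x y => Subtype.ext <| congrArg (Subtype.val (p := (· ∈ I)))
            (map_add m.snd (incl h x) (incl h y))
          map_smul' := fun c x => Subtype.ext <| congrArg (Subtype.val (p := (· ∈ I)))
            (map_smul m.snd c (incl h x))
          cont := (continuous_subtype_val.comp
            (m.snd.continuous.comp (continuous_subtype_val.subtype_mk _))).subtype_mk _ }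
      central := fun x y => Subtype.ext <| congrArg (Subtype.val (p := (· ∈ I)))
        (m.central (incl h x) (incl h y)) }
  map_one' := rfl
  map_mul' _ _ := rfl
  map_zero' := rfl
  map_add' _ _ := rfl
  commutes' _ := rfl
  map_star' _ := rfl

end Multiplier

/-- The annihilator `I^⊥ = {a ∈ A : a x = 0 for all x ∈ I}`. -/
def perp (I : ClosedIdeal A) : ClosedIdeal A where
  carrier := {a | ∀ x ∈ I, a * x = 0}
  add_mem' ha hb x hx := by rw [add_mul, ha x hx, hb x hx, add_zero]
  zero_mem' x _ := zero_mul x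
  smul_mem' c a ha x hx := by rw [smul_mul_assoc, ha x hx, smul_zero]
  isClosed' := by
    simp only [Set.ofPred_forall]
    exact isClosed_iInter fun x => isClosed_iInter fun _ =>
      isClosed_eq (continuous_mul_const x) continuous_const
  mul_mem_left' b a ha x hx := by rw [mul_assoc, ha x hx, mul_zero]
  mul_mem_right' b a ha x hx := by rw [mul_assoc, ha _ (I.mul_mem_left b hx)]

/-- A closed ideal is essential if its annihilator is zero. -/
def IsEssential (I : ClosedIdeal A) : Prop := ∀ a ∈ I.perp, a = 0

theorem perp_mul {I : ClosedIdeal A} {a x : A} (ha : a ∈ I.perp) (hx : x ∈ I) : a * x = 0 :=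
  ha x hx

theorem mul_perp {I : ClosedIdeal A} {a x : A} (ha : a ∈ I.perp) (hx : x ∈ I) : x * a = 0 := by
  have := perp_mul (I.perp.star_mem' ha) (I.star_mem' hx)
  rw [← star_mul] at this
  exact star_eq_zero.1 this

theorem norm_le_of_perp {I : ClosedIdeal A} {a x : A} (ha : a ∈ I.perp) (hx : x ∈ I) :
    ‖x‖ ≤ ‖x + a‖ := by
  have h : star x * (x + a) = star x * x := by
    rw [mul_add, mul_perp ha (I.star_mem' hx), add_zero]
  have h2 : ‖x‖ * ‖x‖ ≤ ‖x‖ * ‖x + a‖ := by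
    rw [← CStarRing.norm_star_mul_self, ← h]
    simpa using norm_mul_le (star x) (x + a)
  rcases (norm_nonneg x).eq_or_lt with h0 | h0
  · rw [← h0]; positivity
  · exact le_of_mul_le_mul_left h2 h0

theorem restrict_injective {I J : ClosedIdeal A} (h : J ≤ I) (hJ : J.IsEssential) :
    Function.Injective (restrict h) := by
  rw [injective_iff_map_eq_zero]
  intro m hm
  have hf : ∀ x : J, m.fst (incl h x) = 0 := fun x => by
    have := congrArg (fun n : 𝓜(ℂ, J) => ((n.fst x : J) : A)) hm
    exact Subtype.ext this
  have : m.fst = 0 := by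
    ext x
    refine hJ _ fun y hy => ?_
    have h1 := fst_mul m x (incl h ⟨y, hy⟩)
    have h2 : x * incl h ⟨y, hy⟩ = incl h ⟨x * y, J.mul_mem_left _ hy⟩ := rfl
    rw [h2, hf] at h1
    exact (congrArg Subtype.val h1).symm
  rw [← norm_eq_zero, ← DoubleCentralizer.norm_fst, this, norm_zero]

/-- The sum `I ⊕ I^⊥`, which is a closed ideal. -/
def sumPerp (I : ClosedIdeal A) : ClosedIdeal A where
  toSubmodule := I.toSubmodule ⊔ I.perp.toSubmodule
  isClosed' := by
    rw [← isSeqClosed_iff_isClosed]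
    intro u b hu hb
    have hdec : ∀ n, ∃ x ∈ I, ∃ y ∈ I.perp, x + y = u n := fun n => Submodule.mem_sup.1 (hu n)
    choose x hx y hy hxy using hdec
    have hcau : CauchySeq x := by
      have hcu := hb.cauchySeq
      rw [Metric.cauchySeq_iff] at hcu ⊢
      intro ε hε
      obtain ⟨N, hN⟩ := hcu ε hε
      refine ⟨N, fun m hm n hn => lt_of_le_of_lt ?_ (hN m hm n hn)⟩
      rw [dist_eq_norm, dist_eq_norm, ← hxy, ← hxy, add_sub_add_comm]
      exact norm_le_of_perp (sub_mem (hy m) (hy n)) (sub_mem (hx m) (hx n))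
    obtain ⟨x₀, hx₀⟩ := cauchySeq_tendsto_of_complete hcau
    have hx₀' : x₀ ∈ I := I.isClosed.mem_of_tendsto hx₀ (.of_forall hx)
    have hy₀ : b - x₀ ∈ I.perp := I.perp.isClosed.mem_of_tendsto (hb.sub hx₀)
      (.of_forall fun n => by rw [← hxy]; simpa using hy n)
    exact Submodule.mem_sup.2 ⟨x₀, hx₀', b - x₀, hy₀, by abel⟩
  mul_mem_left' a z hz := by
    obtain ⟨x, hx, y, hy, rfl⟩ := Submodule.mem_sup.1 hz
    rw [mul_add]
    exact Submodule.mem_sup.2 ⟨_, I.mul_mem_left a hx, _, I.perp.mul_mem_left a hy, rfl⟩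
  mul_mem_right' a z hz := by
    obtain ⟨x, hx, y, hy, rfl⟩ := Submodule.mem_sup.1 hz
    rw [add_mul]
    exact Submodule.mem_sup.2 ⟨_, I.mul_mem_right a hx, _, I.perp.mul_mem_right a hy, rfl⟩

theorem mem_sumPerp {I : ClosedIdeal A} {z : A} :
    z ∈ I.sumPerp ↔ ∃ x ∈ I, ∃ y ∈ I.perp, x + y = z := Submodule.mem_sup

theorem le_sumPerp (I : ClosedIdeal A) : I ≤ I.sumPerp := fun x hx =>
  mem_sumPerp.2 ⟨x, hx, 0, zero_mem _, add_zero x⟩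

theorem perp_le_sumPerp (I : ClosedIdeal A) : I.perp ≤ I.sumPerp := fun x hx =>
  mem_sumPerp.2 ⟨0, zero_mem _, x, hx, zero_add x⟩

theorem sumPerp_isEssential (I : ClosedIdeal A) : I.sumPerp.IsEssential := fun a ha => by
  have h1 : a ∈ I.perp := fun x hx => ha x (I.le_sumPerp hx)
  exact (CStarRing.mul_star_self_eq_zero_iff a).1
    (ha _ (I.perp_le_sumPerp (I.perp.star_mem' h1)))

theorem eq_of_add_perp {I : ClosedIdeal A} {x x' y y' : A} (hx : x ∈ I) (hx' : x' ∈ I)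
    (hy : y ∈ I.perp) (hy' : y' ∈ I.perp) (h : x + y = x' + y') : x = x' := by
  have := norm_le_of_perp (sub_mem hy hy') (sub_mem hx hx')
  rw [← add_sub_add_comm, h, sub_self, norm_zero] at this
  exact sub_eq_zero.1 (norm_le_zero_iff.1 this)

/-- The projection `I ⊕ I^⊥ → I`. -/
def proj (I : ClosedIdeal A) (z : I.sumPerp) : I :=
  ⟨(mem_sumPerp.1 z.2).choose, (mem_sumPerp.1 z.2).choose_spec.1⟩

theorem sub_proj_mem (I : ClosedIdeal A) (z : I.sumPerp) : (z : A) - I.proj z ∈ I.perp := by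
  obtain ⟨y, hy, h⟩ := (mem_sumPerp.1 z.2).choose_spec.2
  have h2 : (z : A) - I.proj z = y := sub_eq_of_eq_add' h.symm
  rw [h2]
  exact hy

theorem proj_eq (I : ClosedIdeal A) {z : I.sumPerp} {x : I} (h : (z : A) - x ∈ I.perp) :
    I.proj z = x :=
  Subtype.ext <| eq_of_add_perp (I.proj z).2 x.2 (I.sub_proj_mem z) h (by abel)

/-- The projection `I ⊕ I^⊥ → I` as a continuous linear map. -/
def projL (I : ClosedIdeal A) : I.sumPerp →L[ℂ] I :=
  LinearMap.mkContinuous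
    { toFun := I.proj
      map_add' := fun z w => I.proj_eq <| by
        have := add_mem (I.sub_proj_mem z) (I.sub_proj_mem w)
        rw [← add_sub_add_comm] at this
        exact this
      map_smul' := fun c z => I.proj_eq <| by
        have := SMulMemClass.smul_mem c (I.sub_proj_mem z)
        rw [smul_sub] at this
        exact this } 1 fun z => by
      have := norm_le_of_perp (I.sub_proj_mem z) (I.proj z).2
      rw [add_sub_cancel] at this
      rw [one_mul]
      exact this

/-- The inclusion `I → I ⊕ I^⊥` as a continuous linear map. -/
def inclSumPerpL (I : ClosedIdeal A) : I →L[ℂ] I.sumPerp where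
  toFun := incl I.le_sumPerp
  map_add' _ _ := rfl
  map_smul' _ _ := rfl
  cont := continuous_subtype_val.subtype_mk _

/-- Extension of multipliers by zero, `M(I) → M(I ⊕ I^⊥)`, `m ↦ (x + y ↦ m x)`. -/
def extendByZero (I : ClosedIdeal A) (m : 𝓜(ℂ, I)) : 𝓜(ℂ, I.sumPerp) where
  fst := I.inclSumPerpL ∘L m.fst ∘L I.projL
  snd := I.inclSumPerpL ∘L m.snd ∘L I.projL
  central z w := by
    apply Subtype.ext
    change (m.snd (I.proj z) : A) * w = z * (m.fst (I.proj w) : A)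
    have h1 : (m.snd (I.proj z) : A) * (w - I.proj w) = 0 :=
      mul_perp (I.sub_proj_mem w) (m.snd (I.proj z)).2
    have h2 : ((z : A) - I.proj z) * (m.fst (I.proj w) : A) = 0 :=
      perp_mul (I.sub_proj_mem z) (m.fst (I.proj w)).2
    rw [mul_sub, sub_eq_zero] at h1
    rw [sub_mul, sub_eq_zero] at h2
    rw [h1, h2]
    exact congrArg Subtype.val (m.central (I.proj z) (I.proj w))

/-- The whole algebra as a closed ideal. -/
def whole (A : Type*) [NonUnitalCStarAlgebra A] : ClosedIdeal A where
  toSubmodule := ⊤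
  isClosed' := isClosed_univ
  mul_mem_left' _ _ _ := trivial
  mul_mem_right' _ _ _ := trivial

theorem mem_whole (a : A) : a ∈ whole A := trivial

theorem whole_isEssential : (whole A).IsEssential := fun a ha =>
  (CStarRing.mul_star_self_eq_zero_iff a).1 (ha _ (mem_whole _))

/-- The intersection of two closed ideals. -/
def inter (I J : ClosedIdeal A) : ClosedIdeal A where
  toSubmodule := I.toSubmodule ⊓ J.toSubmodule
  isClosed' := I.isClosed.inter J.isClosed
  mul_mem_left' a _ hx := ⟨I.mul_mem_left a hx.1, J.mul_mem_left a hx.2⟩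
  mul_mem_right' a _ hx := ⟨I.mul_mem_right a hx.1, J.mul_mem_right a hx.2⟩

theorem IsEssential.inter {I J : ClosedIdeal A} (hI : I.IsEssential) (hJ : J.IsEssential) :
    (I.inter J).IsEssential := fun a ha => by
  refine hI a fun x hx => hJ _ fun y hy => ?_
  rw [mul_assoc]
  exact ha _ ⟨I.mul_mem_right y hx, J.mul_mem_left x hy⟩

end ClosedIdeal

/-- The essential closed ideals of `A`, ordered by reverse inclusion: `I ≤ J` means `J ⊆ I`. -/
structure EssentialIdeal (A : Type*) [NonUnitalCStarAlgebra A] where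
  ideal : ClosedIdeal A
  essential : ideal.IsEssential

namespace EssentialIdeal

variable {A : Type*} [NonUnitalCStarAlgebra A]

instance : Preorder (EssentialIdeal A) where
  le I J := J.1 ≤ I.1
  le_refl I := le_refl I.1
  le_trans _ _ _ h h' := le_trans h' h

instance : Nonempty (EssentialIdeal A) := ⟨⟨ClosedIdeal.whole A, ClosedIdeal.whole_isEssential⟩⟩

instance : IsDirectedOrder (EssentialIdeal A) where
  directed I J := ⟨⟨I.1.inter J.1, I.2.inter J.2⟩, fun _ h => h.1, fun _ h => h.2⟩

/-- The multiplier algebra of an essential ideal. -/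
abbrev Mult (I : EssentialIdeal A) : Type _ := 𝓜(ℂ, I.ideal)

/-- The restriction maps `M(I) → M(J)` for essential ideals `J ⊆ I`. -/
abbrev res (I J : EssentialIdeal A) (h : I ≤ J) : I.Mult →⋆ₐ[ℂ] J.Mult :=
  ClosedIdeal.restrict h

instance : DirectedSystem (Mult (A := A)) (res · · ·) where
  map_self _ _ := rfl
  map_map _ _ _ _ _ _ := rfl

theorem norm_res {I J : EssentialIdeal A} (h : I ≤ J) (m : I.Mult) : ‖res I J h m‖ = ‖m‖ :=
  NonUnitalStarAlgHom.norm_map (res I J h) (ClosedIdeal.restrict_injective h J.2) m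

end EssentialIdeal

/-- The algebraic direct limit of the multiplier algebras `M(I)` over the essential ideals `I`. -/
def AlgLocalMultiplier (A : Type*) [NonUnitalCStarAlgebra A] : Type _ :=
  DirectLimit (EssentialIdeal.Mult (A := A)) EssentialIdeal.res

namespace AlgLocalMultiplier

variable {A : Type*} [NonUnitalCStarAlgebra A]

instance : Ring (AlgLocalMultiplier A) :=
  inferInstanceAs (Ring (DirectLimit (EssentialIdeal.Mult (A := A)) EssentialIdeal.res))

instance : StarMul (AlgLocalMultiplier A) :=
  inferInstanceAs (StarMul (DirectLimit (EssentialIdeal.Mult (A := A)) EssentialIdeal.res))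

/-- The class in the direct limit of a multiplier of an essential ideal. -/
def of (I : EssentialIdeal A) (m : I.Mult) : AlgLocalMultiplier A := Quotient.mk _ ⟨I, m⟩

theorem exists_of (x : AlgLocalMultiplier A) : ∃ I m, x = of I m := DirectLimit.exists_eq_mk _ x

theorem exists_of₂ (x y : AlgLocalMultiplier A) : ∃ I m n, x = of I m ∧ y = of I n :=
  DirectLimit.exists_eq_mk₂ _ x y

theorem of_add (I : EssentialIdeal A) (m n : I.Mult) : of I m + of I n = of I (m + n) :=
  DirectLimit.add_def I m n

theorem of_mul (I : EssentialIdeal A) (m n : I.Mult) : of I m * of I n = of I (m * n) :=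
  DirectLimit.mul_def I m n

theorem of_neg (I : EssentialIdeal A) (m : I.Mult) : -of I m = of I (-m) := rfl

theorem of_zero (I : EssentialIdeal A) : of I 0 = 0 := (DirectLimit.zero_def I).symm

theorem of_star (I : EssentialIdeal A) (m : I.Mult) : star (of I m) = of I (star m) := rfl

instance : StarRing (AlgLocalMultiplier A) where
  star_add x y := by
    obtain ⟨I, m, n, rfl, rfl⟩ := exists_of₂ x y
    simp only [of_add, of_star, star_add]

instance : SMul ℂ (AlgLocalMultiplier A) where
  smul c := DirectLimit.map _ _ (fun _ m => c • m) fun I J h m => map_smul (EssentialIdeal.res I J h) c m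

theorem of_smul (I : EssentialIdeal A) (c : ℂ) (m : I.Mult) : c • of I m = of I (c • m) := rfl

instance : Module ℂ (AlgLocalMultiplier A) where
  one_smul x := by
    obtain ⟨I, m, rfl⟩ := exists_of x
    rw [of_smul, one_smul]
  mul_smul a b x := by
    obtain ⟨I, m, rfl⟩ := exists_of x
    simp only [of_smul, mul_smul]
  smul_zero a := by
    rw [← of_zero (Classical.arbitrary _), of_smul, smul_zero]
  smul_add a x y := by
    obtain ⟨I, m, n, rfl, rfl⟩ := exists_of₂ x y
    simp only [of_smul, of_add, smul_add]
  add_smul a b x := by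
    obtain ⟨I, m, rfl⟩ := exists_of x
    simp only [of_smul, of_add, add_smul]
  zero_smul x := by
    obtain ⟨I, m, rfl⟩ := exists_of x
    rw [of_smul, zero_smul, of_zero]

instance : Algebra ℂ (AlgLocalMultiplier A) :=
  Algebra.ofModule
    (fun c x y => by
      obtain ⟨I, m, n, rfl, rfl⟩ := exists_of₂ x y
      simp only [of_smul, of_mul, smul_mul_assoc])
    (fun c x y => by
      obtain ⟨I, m, n, rfl, rfl⟩ := exists_of₂ x y
      simp only [of_smul, of_mul, mul_smul_comm])

instance : StarModule ℂ (AlgLocalMultiplier A) where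
  star_smul c x := by
    obtain ⟨I, m, rfl⟩ := exists_of x
    simp only [of_smul, of_star, star_smul]

/-- The norm of the direct limit: the restriction maps are isometric. -/
instance : Norm (AlgLocalMultiplier A) where
  norm := DirectLimit.lift _ (fun _ m => ‖m‖) fun _ _ h m => (EssentialIdeal.norm_res h m).symm

theorem norm_of (I : EssentialIdeal A) (m : I.Mult) : ‖of I m‖ = ‖m‖ := rfl

instance : NormedRing (AlgLocalMultiplier A) where
  __ := AddGroupNorm.toNormedAddCommGroup (E := AlgLocalMultiplier A)
    { toFun := norm
      map_zero' := by rw [← of_zero (Classical.arbitrary _), norm_of, norm_zero]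
      add_le' := fun x y => by
        obtain ⟨I, m, n, rfl, rfl⟩ := exists_of₂ x y
        simpa only [of_add, norm_of] using norm_add_le m n
      neg' := fun x => by
        obtain ⟨I, m, rfl⟩ := exists_of x
        rw [of_neg, norm_of, norm_of, norm_neg]
      eq_zero_of_map_eq_zero' := fun x hx => by
        obtain ⟨I, m, rfl⟩ := exists_of x
        rw [norm_of, norm_eq_zero] at hx
        rw [hx, of_zero] }
  __ := (inferInstance : Ring (AlgLocalMultiplier A))
  norm_mul_le x y := by
    obtain ⟨I, m, n, rfl, rfl⟩ := exists_of₂ x y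
    rw [of_mul]
    exact norm_mul_le m n

instance : CStarRing (AlgLocalMultiplier A) where
  norm_mul_self_le x := by
    obtain ⟨I, m, rfl⟩ := exists_of x
    rw [of_star, of_mul]
    exact CStarRing.norm_mul_self_le m

instance : NormedAlgebra ℂ (AlgLocalMultiplier A) where
  norm_smul_le c x := by
    obtain ⟨I, m, rfl⟩ := exists_of x
    rw [of_smul]
    exact norm_smul_le c m

end AlgLocalMultiplier

/-- The local multiplier algebra `M_loc(A)`: the C⋆-algebraic direct limit (the completion of the
algebraic direct limit) of the multiplier algebras `M(I)` over the essential ideals `I` of `A`. -/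
def LocalMultiplier (A : Type*) [NonUnitalCStarAlgebra A] : Type _ :=
  UniformSpace.Completion (AlgLocalMultiplier A)

namespace LocalMultiplier

open UniformSpace

variable {A : Type*} [NonUnitalCStarAlgebra A]

instance : NormedRing (LocalMultiplier A) :=
  inferInstanceAs (NormedRing (Completion (AlgLocalMultiplier A)))

instance : NormedSpace ℂ (LocalMultiplier A) :=
  inferInstanceAs (NormedSpace ℂ (Completion (AlgLocalMultiplier A)))

instance : CompleteSpace (LocalMultiplier A) :=
  inferInstanceAs (CompleteSpace (Completion (AlgLocalMultiplier A)))

/-- The embedding of the algebraic direct limit into its completion. -/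
def ofAlg (x : AlgLocalMultiplier A) : LocalMultiplier A := (x : Completion (AlgLocalMultiplier A))

theorem denseRange_ofAlg : DenseRange (ofAlg (A := A)) := Completion.denseRange_coe

theorem continuous_ofAlg : Continuous (ofAlg (A := A)) :=
  Completion.continuous_coe (AlgLocalMultiplier A)

theorem norm_ofAlg (x : AlgLocalMultiplier A) : ‖ofAlg x‖ = ‖x‖ := Completion.norm_coe x

theorem ofAlg_add (x y : AlgLocalMultiplier A) : ofAlg (x + y) = ofAlg x + ofAlg y :=
  Completion.coe_add x y

theorem ofAlg_mul (x y : AlgLocalMultiplier A) : ofAlg (x * y) = ofAlg x * ofAlg y :=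
  Completion.coe_mul x y

theorem ofAlg_smul (c : ℂ) (x : AlgLocalMultiplier A) : ofAlg (c • x) = c • ofAlg x :=
  Completion.coe_smul c x

/-- The involution is the continuous extension of that of the algebraic direct limit. -/
instance : Star (LocalMultiplier A) where
  star := Completion.map (star : AlgLocalMultiplier A → AlgLocalMultiplier A)

theorem continuous_star : Continuous (star : LocalMultiplier A → LocalMultiplier A) :=
  Completion.continuous_map

theorem ofAlg_star (x : AlgLocalMultiplier A) : ofAlg (star x) = star (ofAlg x) :=
  (Completion.map_coe (starₗᵢ ℂ (E := AlgLocalMultiplier A)).isometry.uniformContinuous x).symm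

instance : StarRing (LocalMultiplier A) where
  star_involutive x := by
    refine denseRange_ofAlg.induction_on (p := fun x => star (star x) = x) x
      (isClosed_eq (continuous_star.comp continuous_star) continuous_id) fun y => ?_
    rw [← ofAlg_star, ← ofAlg_star, star_star]
  star_mul x y := by
    refine denseRange_ofAlg.induction_on₂ (p := fun x y => star (x * y) = star y * star x)
      (isClosed_eq (continuous_star.comp continuous_mul)
        ((continuous_star.comp continuous_snd).mul (continuous_star.comp continuous_fst)))
      (fun a b => ?_) x y
    rw [← ofAlg_mul, ← ofAlg_star, ← ofAlg_star, ← ofAlg_star, ← ofAlg_mul, star_mul]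
  star_add x y := by
    refine denseRange_ofAlg.induction_on₂ (p := fun x y => star (x + y) = star x + star y)
      (isClosed_eq (continuous_star.comp continuous_add)
        ((continuous_star.comp continuous_fst).add (continuous_star.comp continuous_snd)))
      (fun a b => ?_) x y
    rw [← ofAlg_add, ← ofAlg_star, ← ofAlg_star, ← ofAlg_star, ← ofAlg_add, star_add]

instance : CStarRing (LocalMultiplier A) where
  norm_mul_self_le x := by
    refine denseRange_ofAlg.induction_on (p := fun x => ‖x‖ * ‖x‖ ≤ ‖star x * x‖) x
      (isClosed_le (continuous_norm.mul continuous_norm)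
        (continuous_norm.comp (continuous_star.mul continuous_id))) fun y => ?_
    rw [← ofAlg_star, ← ofAlg_mul, norm_ofAlg, norm_ofAlg]
    exact CStarRing.norm_mul_self_le y

theorem smul_mul (c : ℂ) (x y : LocalMultiplier A) : c • x * y = c • (x * y) := by
  refine denseRange_ofAlg.induction_on₂ (p := fun x y => c • x * y = c • (x * y))
    (isClosed_eq ((continuous_fst.const_smul c).mul continuous_snd)
      (continuous_mul.const_smul c)) (fun a b => ?_) x y
  rw [← ofAlg_mul, ← ofAlg_smul, ← ofAlg_smul, ← ofAlg_mul, smul_mul_assoc]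

theorem mul_smul (c : ℂ) (x y : LocalMultiplier A) : x * c • y = c • (x * y) := by
  refine denseRange_ofAlg.induction_on₂ (p := fun x y => x * c • y = c • (x * y))
    (isClosed_eq (continuous_fst.mul (continuous_snd.const_smul c))
      (continuous_mul.const_smul c)) (fun a b => ?_) x y
  rw [← ofAlg_mul, ← ofAlg_smul, ← ofAlg_smul, ← ofAlg_mul, mul_smul_comm]

instance : Algebra ℂ (LocalMultiplier A) := Algebra.ofModule smul_mul mul_smul

instance : NormedAlgebra ℂ (LocalMultiplier A) where
  norm_smul_le c x := norm_smul_le c x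

instance : StarModule ℂ (LocalMultiplier A) where
  star_smul c x := by
    refine denseRange_ofAlg.induction_on (p := fun x => star (c • x) = star c • star x) x
      (isClosed_eq (continuous_star.comp (continuous_const_smul c))
        (continuous_star.const_smul (star c))) fun y => ?_
    rw [← ofAlg_smul, ← ofAlg_star, ← ofAlg_star, ← ofAlg_smul, star_smul]

instance : CStarAlgebra (LocalMultiplier A) where

instance : PartialOrder (LocalMultiplier A) := CStarAlgebra.spectralOrder _

instance : StarOrderedRing (LocalMultiplier A) := CStarAlgebra.spectralOrderedRing _

/-- The canonical map `M(I) → M_loc(A)` for an essential ideal `I`. -/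
def ofMultiplier (I : EssentialIdeal A) (m : I.Mult) : LocalMultiplier A :=
  ofAlg (AlgLocalMultiplier.of I m)

/-- The canonical embedding `A ⊆ M(A) ⊆ M_loc(A)`. -/
def ofElem (a : A) : LocalMultiplier A :=
  ofMultiplier ⟨ClosedIdeal.whole A, ClosedIdeal.whole_isEssential⟩
    (DoubleCentralizer.coe ℂ (⟨a, ClosedIdeal.mem_whole a⟩ : ClosedIdeal.whole A))

/-- The canonical inclusion `M(J) ⊆ M_loc(J) ⊆ M_loc(A)` for an arbitrary closed ideal `J` of `A`:
a multiplier of `J` is extended by zero to the essential ideal `J ⊕ J^⊥`. -/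
def ofIdealMultiplier (J : ClosedIdeal A) (m : 𝓜(ℂ, J)) : LocalMultiplier A :=
  ofMultiplier ⟨J.sumPerp, J.sumPerp_isEssential⟩ (J.extendByZero m)

end LocalMultiplier

/-! ### Inclusions `A ⊆ B` of C⋆-algebras -/

section Inclusion

variable {B : Type*} [NonUnitalCStarAlgebra B]

/-- `A` is a maximal abelian C⋆-subalgebra (masa) of `B`. -/
def IsMasa (A : NonUnitalStarSubalgebra ℂ B) : Prop :=
  Maximal (fun C : NonUnitalStarSubalgebra ℂ B =>
    IsClosed (C : Set B) ∧ ∀ x ∈ C, ∀ y ∈ C, x * y = y * x) A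

/-- `n ∈ B` normalises `A` if `n⋆ A n ⊆ A` and `n A n⋆ ⊆ A`. -/
def IsNormaliser (A : NonUnitalStarSubalgebra ℂ B) (n : B) : Prop :=
  ∀ a ∈ A, star n * a * n ∈ A ∧ n * a * star n ∈ A

/-- The inclusion `A ⊆ B` is regular if the normalisers span a dense subspace of `B`. -/
def IsRegularInclusion (A : NonUnitalStarSubalgebra ℂ B) : Prop :=
  Dense (Submodule.span ℂ {n : B | IsNormaliser A n} : Set B)

/-- `D` is a hereditary C⋆-subalgebra of `A` (positivity in `A` and in `B` agree). -/
structure IsHereditarySubalgebra [PartialOrder B] (A D : NonUnitalStarSubalgebra ℂ B) : Prop where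
  le : D ≤ A
  isClosed : IsClosed (D : Set B)
  mem_of_le : ∀ a ∈ A, ∀ d ∈ D, 0 ≤ a → a ≤ d → a ∈ D

/-- The inclusion `A ⊆ B` is aperiodic: the Banach `A`-bimodule `B / A` is aperiodic, that is, for
every `ε > 0`, every nonzero hereditary subalgebra `D ⊆ A` and every `x ∈ B / A` (the class of some
`b ∈ B`) there is `a ∈ D` with `a ≥ 0`, `‖a‖ = 1` and `‖a x a‖ < ε` in the quotient norm. -/
def IsAperiodicInclusion [PartialOrder B] (A : NonUnitalStarSubalgebra ℂ B) : Prop :=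
  ∀ ε : ℝ, 0 < ε → ∀ D : NonUnitalStarSubalgebra ℂ B, IsHereditarySubalgebra A D → D ≠ ⊥ →
    ∀ b : B, ∃ a ∈ D, 0 ≤ a ∧ ‖a‖ = 1 ∧
      ‖(Submodule.Quotient.mk (a * b * a) : B ⧸ A.toNonUnitalSubalgebra.toSubmodule)‖ < ε

/-- A slice of `A ⊆ B`: a closed linear subspace `W` of `B` consisting of normalisers, with
`A W + W A ⊆ W` and `W⋆ W + W W⋆ ⊆ A`. -/
structure IsSlice (A : NonUnitalStarSubalgebra ℂ B) (W : Submodule ℂ B) : Prop where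
  isClosed : IsClosed (W : Set B)
  isNormaliser : ∀ w ∈ W, IsNormaliser A w
  mul_mem_left : ∀ a ∈ A, ∀ w ∈ W, a * w ∈ W
  mul_mem_right : ∀ a ∈ A, ∀ w ∈ W, w * a ∈ W
  star_mul_mem : ∀ v ∈ W, ∀ w ∈ W, star v * w ∈ A
  mul_star_mem : ∀ v ∈ W, ∀ w ∈ W, v * star w ∈ A

/-- For a slice `W`, the intersection `W ∩ A` is a closed ideal of `A`. -/
def IsSlice.interIdeal {A : NonUnitalStarSubalgebra ℂ B} [IsClosed (A : Set B)]
    {W : Submodule ℂ B} (hW : IsSlice A W) : ClosedIdeal A where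
  carrier := {a | (a : B) ∈ W}
  add_mem' ha hb := W.add_mem ha hb
  zero_mem' := W.zero_mem
  smul_mem' c _ ha := W.smul_mem c ha
  isClosed' := hW.isClosed.preimage continuous_subtype_val
  mul_mem_left' a _ hx := hW.mul_mem_left a a.2 _ hx
  mul_mem_right' a _ hx := hW.mul_mem_right a a.2 _ hx

open scoped CStarAlgebra in
/-- A local (conditional) expectation for `A ⊆ B`: a completely positive contractive linear map
`E : B → M_loc(A)` which restricts to the canonical embedding on `A`. -/
structure IsLocalExpectation [PartialOrder B] [StarOrderedRing B]
    (A : NonUnitalStarSubalgebra ℂ B) [IsClosed (A : Set B)]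
    (E : B →CP LocalMultiplier A) : Prop where
  contractive : ∀ b : B, ‖E b‖ ≤ ‖b‖
  apply_coe : ∀ a : A, E (a : B) = LocalMultiplier.ofElem a

end Inclusion

end

noncomputable section

open Filter Topology

/-! ### Approximate units of C⋆-subalgebras -/

section ApproximateUnit

variable {B : Type*} [NonUnitalCStarAlgebra B]

/-! All three statements rest on one compression property: if `n` normalises `A` and `d ∈ A` is
nonzero, some `g ∈ A` satisfies `d g ≠ 0` and `(d g) n (d g) ∈ A`
(`IsMasa.exists_compression_normaliser`).

The first ingredient is `n n⋆ ∈ A`. By maximality it suffices that `n n⋆` commutes with `A`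
(`IsNormaliser.mul_star_comm`). This needs an argument because an approximate unit of `A` is not
assumed to be one for `B`. It follows from the identity `d (n n⋆) e = e (n n⋆) d` for self-adjoint
`d, e ∈ A`, by letting `d` run through an approximate unit of `A`.

For the compression, if `d n d ∉ A`, then `d n d` fails to commute with some `f ∈ A`. A character
`χ` of `A` detects this failure. Let `ψ` be the character `a ↦ χ (n⋆ a n) / χ (n⋆ n)`. Then `χ f ≠ ψ
f`, so orthogonal `u, v ∈ A` exist with `χ u ≠ 0` and `ψ v ≠ 0`. The choice `g = u (n⋆ v n)` makes
the compression of `n` zero, while `χ (d g) ≠ 0`.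

Aperiodicity follows by approximating `b` by a sum `s` of normalisers and compressing `s` into `A`;
the error is controlled by `‖b - s‖`.

For uniqueness, complete positivity makes a local expectation `A`-bilinear on normalisers
(`IsLocalExpectation.map_normaliser_mul`). Hence two expectations agree on compressed normalisers,
and `eq_zero_of_compression` removes the compression: the annihilator in `A` of the difference is an
essential ideal, and essential ideals detect elements of `M_loc(A)`.

For a slice `W` and `w ∈ W`, `E w` is tested on the essential ideal `J ⊕ J^⊥`, where `J = W ∩ A`. On
`J` it acts as multiplication by `w`, because `w J ⊆ A`. On `J^⊥` it acts as zero, because every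
compression of `w y` into `A`, for `y ∈ J^⊥`, vanishes. -/

/-- A C⋆-subalgebra has an approximate unit of self-adjoint contractions, given here as a filter on
the ambient algebra. -/
theorem NonUnitalStarSubalgebra.exists_approximateUnit (C : NonUnitalStarSubalgebra ℂ B)
    [IsClosed (C : Set B)] :
    ∃ l : Filter B, l.NeBot ∧ (∀ᶠ g in l, g ∈ C ∧ star g = g ∧ ‖g‖ ≤ 1) ∧
      ∀ x ∈ C, Tendsto (fun g => g * x) l (𝓝 x) := by
  let _ : PartialOrder C := CStarAlgebra.spectralOrder C
  have : StarOrderedRing C := CStarAlgebra.spectralOrderedRing C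
  have hl := CStarAlgebra.increasingApproximateUnit C
  have := hl.neBot
  refine ⟨(CStarAlgebra.approximateUnit C).map Subtype.val, inferInstance, ?_, fun x hx => ?_⟩
  · rw [eventually_map]
    filter_upwards [hl.eventually_norm, hl.eventually_star_eq] with e he hes
    exact ⟨e.2, congrArg Subtype.val hes, he⟩
  · rw [tendsto_map'_iff]
    exact (continuous_subtype_val.tendsto _).comp (hl.tendsto_mul_right ⟨x, hx⟩)

/-- If self-adjoint contractions `g` satisfy `g z z⋆ → z z⋆`, then `g z → z`. -/
theorem tendsto_mul_of_mul_star {l : Filter B} (hl : ∀ᶠ g in l, star g = g ∧ ‖g‖ ≤ 1) {z : B}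
    (hz : Tendsto (fun g => g * (z * star z)) l (𝓝 (z * star z))) :
    Tendsto (fun g => g * z) l (𝓝 z) := by
  set p := z * star z with hp
  have hbd : ∀ᶠ g in l, ‖g * z - z‖ ^ 2 ≤ 2 * ‖g * p - p‖ := by
    filter_upwards [hl] with g ⟨hgs, hg⟩
    have h : (g * z - z) * star (g * z - z) = (g * p - p) * g - (g * p - p) := by
      rw [star_sub, star_mul, hgs, hp]
      noncomm_ring
    rw [sq, ← CStarRing.norm_self_mul_star, h]
    calc ‖(g * p - p) * g - (g * p - p)‖ ≤ ‖g * p - p‖ * ‖g‖ + ‖g * p - p‖ :=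
          (norm_sub_le _ _).trans (by gcongr; exact norm_mul_le _ _)
      _ ≤ ‖g * p - p‖ * 1 + ‖g * p - p‖ := by gcongr
      _ = 2 * ‖g * p - p‖ := by ring
  have h0 : Tendsto (fun g => ‖g * p - p‖) l (𝓝 0) := tendsto_iff_norm_sub_tendsto_zero.1 hz
  have h1 : Tendsto (fun g => ‖g * z - z‖ ^ 2) l (𝓝 0) :=
    squeeze_zero' (.of_forall fun _ => by positivity) hbd (by simpa using h0.const_mul 2)
  rw [tendsto_iff_norm_sub_tendsto_zero]
  simpa using h1.sqrt

theorem tendsto_mul_star_of_tendsto {l : Filter B} (hl : ∀ᶠ g in l, star g = g ∧ ‖g‖ ≤ 1) {z : B}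
    (hz : Tendsto (fun g => g * star z) l (𝓝 (star z))) :
    Tendsto (fun g => z * g) l (𝓝 z) := by
  have := hz.star
  rw [star_star] at this
  refine this.congr' ?_
  filter_upwards [hl] with g hg
  rw [star_mul, star_star, hg.1]

/-- The right annihilator of the left annihilator of `k`, made self-adjoint. -/
def biannihilator (k : B) : NonUnitalStarSubalgebra ℂ B where
  carrier := {g | ∀ z, z * k = 0 → z * g = 0 ∧ z * star g = 0}
  add_mem' hg hh z hz := by
    rw [star_add, mul_add, mul_add, (hg z hz).1, (hg z hz).2, (hh z hz).1, (hh z hz).2]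
    simp
  zero_mem' z _ := by simp
  mul_mem' hg hh z hz := by
    rw [star_mul, ← mul_assoc, ← mul_assoc, (hg z hz).1, (hh z hz).2]
    simp
  smul_mem' c g hg z hz := by
    rw [star_smul, mul_smul_comm, mul_smul_comm, (hg z hz).1, (hg z hz).2]
    simp
  star_mem' hg z hz := by
    rw [star_star]
    exact (hg z hz).symm

instance (k : B) : IsClosed (biannihilator k : Set B) := by
  change IsClosed {g | ∀ z, z * k = 0 → z * g = 0 ∧ z * star g = 0}
  simp only [Set.ofPred_forall]
  exact isClosed_iInter fun z => isClosed_iInter fun _ =>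
    (isClosed_eq (continuous_const_mul z) continuous_const).inter
      (isClosed_eq (continuous_star.const_mul z) continuous_const)

end ApproximateUnit

/-! ### Normalisers of abelian subalgebras -/

section Normaliser

variable {B : Type*} [NonUnitalCStarAlgebra B] {A : NonUnitalStarSubalgebra ℂ B}

theorem IsNormaliser.adjoint {n : B} (hn : IsNormaliser A n) : IsNormaliser A (star n) :=
  fun a ha => by
    rw [star_star]
    exact (hn a ha).symm

theorem IsNormaliser.mul_mul_mem {n : B} (hn : IsNormaliser A n) {a : B} (ha : a ∈ A) :
    n * star n * a * (n * star n) ∈ A := by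
  have := (hn _ (hn a ha).1).2
  simpa only [mul_assoc] using this

/-- For self-adjoint `d`, `e` in an abelian subalgebra and a normaliser `n`, the element `n n⋆` is
symmetric between `d` and `e`. -/
theorem IsNormaliser.mul_mul_symm (hA : ∀ x ∈ A, ∀ y ∈ A, x * y = y * x)
    {n : B} (hn : IsNormaliser A n) {d e : B} (hd : d ∈ A) (he : e ∈ A) (hds : star d = d)
    (hes : star e = e) : d * (n * star n) * e = e * (n * star n) * d := by
  set k := n * star n with hk
  have hks : star k = k := by rw [hk, star_mul, star_star]
  -- This approximate unit serves two purposes: it fixes `k`, hence also `x` below, in the limit,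
  -- and `z k = 0` forces `z g = 0`.
  obtain ⟨l, hl0, hl, hlk⟩ := (biannihilator k).exists_approximateUnit
  have hl' : ∀ᶠ g in l, star g = g ∧ ‖g‖ ≤ 1 := hl.mono fun g hg => hg.2
  have hkC : k ∈ biannihilator k := fun z hz => ⟨hz, by rwa [hks]⟩
  have hkw : ∀ w, Tendsto (fun g => g * (k * w)) l (𝓝 (k * w)) := fun w => by
    simpa only [mul_assoc] using (hlk k hkC).mul_const w
  -- Two descents `z z⋆ ⇝ z`: first with `z = e k e`, whose `z z⋆` lies in `k B` because `k e² k ∈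
  -- A` commutes with `e`; then with `z = e n`, whose `z z⋆` is `e k e`.
  have hek : ∀ e ∈ A, star e = e → Tendsto (fun g => g * (e * k)) l (𝓝 (e * k)) := by
    intro e he hes
    have h1 : Tendsto (fun g => g * (e * k * e)) l (𝓝 (e * k * e)) := by
      refine tendsto_mul_of_mul_star hl' ?_
      have : e * k * e * star (e * k * e) = k * ((e * e) * k * (e * e)) := by
        rw [star_mul, star_mul, hes, hks]
        have h2 := hA e he _ (hn.mul_mul_mem (mul_mem he he))
        rw [← hk] at h2
        calc e * k * e * (e * (k * e)) = e * (k * (e * e) * k) * e := by noncomm_ring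
          _ = k * (e * e) * k * e * e := by rw [h2]
          _ = k * ((e * e) * k * (e * e)) := by noncomm_ring
      rw [this]
      exact hkw _
    have h2 : Tendsto (fun g => g * (e * n)) l (𝓝 (e * n)) := by
      refine tendsto_mul_of_mul_star hl' ?_
      have : e * n * star (e * n) = e * k * e := by
        rw [star_mul, hes, hk]; noncomm_ring
      rwa [this]
    have := h2.mul_const (star n)
    simpa only [mul_assoc, hk] using this
  set x := d * k * e - e * k * d with hx
  have hxs : star x = -x := by
    simp only [hx, hk, star_sub, star_mul, star_star, hds, hes]
    noncomm_ring
  have hgx : Tendsto (fun g => g * x) l (𝓝 x) := by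
    have h1 := ((hek d hd hds).mul_const e).sub ((hek e he hes).mul_const d)
    refine h1.congr fun g => ?_
    rw [hx]; noncomm_ring
  have hxg : Tendsto (fun g => x * g) l (𝓝 x) := by
    refine tendsto_mul_star_of_tendsto hl' ?_
    simpa only [hxs, mul_neg] using hgx.neg
  -- The elements `n⋆ d n` and `n⋆ e n` lie in `A`, so they commute.
  have hkxk : k * x * k = 0 := by
    have h1 := hA _ (hn d hd).1 _ (hn e he).1
    have h2 : n * (star n * d * n * (star n * e * n)) * star n
        = n * (star n * e * n * (star n * d * n)) * star n := by rw [h1]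
    have h3 : k * x * k = n * (star n * d * n * (star n * e * n)) * star n
        - n * (star n * e * n * (star n * d * n)) * star n := by
      rw [hx, hk]; noncomm_ring
    rw [h3, h2, sub_self]
  -- The right factor `k` cancels: `k x k = 0` gives `k x g = 0`, and `x g → x`. The same
  -- cancellation after taking adjoints gives `x = 0`.
  have hkx : k * x = 0 := by
    refine tendsto_nhds_unique_of_eventuallyEq (hxg.const_mul k) tendsto_const_nhds ?_
    filter_upwards [hl] with g hg
    rw [← mul_assoc]
    exact (hg.1 _ hkxk).1
  have hxk : x * k = 0 := by
    have := congrArg star hkx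
    rw [star_mul, hks, hxs, star_zero, neg_mul, neg_eq_zero] at this
    exact this
  have hx0 : x = 0 := by
    refine tendsto_nhds_unique_of_eventuallyEq hxg tendsto_const_nhds ?_
    filter_upwards [hl] with g hg
    exact (hg.1 _ hxk).1
  exact sub_eq_zero.1 hx0

/-- If `n` normalises an abelian C⋆-subalgebra, then `n n⋆` commutes with it. -/
theorem IsNormaliser.mul_star_comm [IsClosed (A : Set B)] (hA : ∀ x ∈ A, ∀ y ∈ A, x * y = y * x)
    {n : B} (hn : IsNormaliser A n) {a : B} (ha : a ∈ A) :
    n * star n * a = a * (n * star n) := by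
  set k := n * star n with hk
  have hks : star k = k := by rw [hk, star_mul, star_star]
  obtain ⟨l, hl0, hl, hlA⟩ := A.exists_approximateUnit
  have hl' : ∀ᶠ g in l, star g = g ∧ ‖g‖ ≤ 1 := hl.mono fun g hg => hg.2
  have hke : ∀ e ∈ A, Tendsto (fun g => g * (k * e)) l (𝓝 (k * e)) := fun e he => by
    refine tendsto_mul_of_mul_star hl' (hlA _ ?_)
    have := hn.mul_mul_mem (mul_mem he (star_mem he))
    rw [star_mul, hks]
    simpa only [mul_assoc, hk] using this
  have key : ∀ e ∈ A, star e = e → k * e = e * k := by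
    intro e he hes
    have h1 : Tendsto (fun g => e * k * g) l (𝓝 (e * k)) := by
      refine tendsto_mul_star_of_tendsto hl' ?_
      rw [star_mul, hks, hes]
      exact hke e he
    -- The nets `g k e` and `e k g` coincide by `IsNormaliser.mul_mul_symm`; their limits are `k e`
    -- and `e k`.
    refine tendsto_nhds_unique_of_eventuallyEq (hke e he) h1 ?_
    filter_upwards [hl] with g hg
    rw [← mul_assoc]
    exact hn.mul_mul_symm hA hg.1 he hg.2.1 hes
  have h2 : a = (realPart a : B) + Complex.I • (imaginaryPart a : B) :=
    (realPart_add_I_smul_imaginaryPart a).symm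
  have hre : (realPart a : B) ∈ A := by
    rw [realPart_apply_coe, ← Complex.coe_smul]
    exact SMulMemClass.smul_mem _ (add_mem ha (star_mem ha))
  have him : (imaginaryPart a : B) ∈ A := by
    rw [imaginaryPart_apply_coe, ← Complex.coe_smul]
    exact SMulMemClass.smul_mem (-Complex.I) (SMulMemClass.smul_mem _
      (sub_mem ha (star_mem ha)))
  rw [h2, mul_add, add_mul, mul_smul_comm, smul_mul_assoc,
    key _ hre (realPart a).2.star_eq, key _ him (imaginaryPart a).2.star_eq]

theorem IsMasa.comm (hA : IsMasa A) : ∀ x ∈ A, ∀ y ∈ A, x * y = y * x := hA.prop.2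

/-- A masa contains every self-adjoint element commuting with it. -/
theorem IsMasa.mem_of_selfAdjoint (hA : IsMasa A) {x : B} (hxs : star x = x)
    (hx : ∀ a ∈ A, x * a = a * x) : x ∈ A := by
  let S : Set B := insert x (A : Set B)
  have hScomm : ∀ a ∈ S, ∀ b ∈ S, a * b = b * a := by
    rintro a (rfl | ha) b (rfl | hb)
    · rfl
    · exact hx b hb
    · exact (hx a ha).symm
    · exact hA.comm a ha b hb
  have hSstar : ∀ a ∈ S, ∀ b ∈ S, a * star b = star b * a := by
    rintro a ha b (rfl | hb)
    · rw [hxs]; exact hScomm a ha _ (Set.mem_insert _ _)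
    · exact hScomm a ha _ (Set.mem_insert_of_mem _ (star_mem hb))
  -- A commutative C⋆-algebra containing both `A` and `x`; maximality forces it into `A`.
  let C := (NonUnitalStarAlgebra.adjoin ℂ S).topologicalClosure
  have hAC : A ≤ C := fun a ha => NonUnitalStarSubalgebra.le_topologicalClosure _
    (NonUnitalStarAlgebra.subset_adjoin ℂ S (Set.mem_insert_of_mem _ ha))
  have hC : IsClosed (C : Set B) ∧ ∀ y ∈ C, ∀ z ∈ C, y * z = z * y := by
    refine ⟨NonUnitalStarSubalgebra.isClosed_topologicalClosure _, fun y hy z hz => ?_⟩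
    have := NonUnitalStarAlgebra.isMulCommutative_adjoin ℂ hScomm hSstar
    let _ : NonUnitalCommSemiring C :=
      (NonUnitalStarAlgebra.adjoin ℂ S).nonUnitalCommSemiringTopologicalClosure
        this.is_comm.comm
    exact congrArg Subtype.val (mul_comm (⟨y, hy⟩ : C) ⟨z, hz⟩)
  exact hA.le_of_ge hC hAC (NonUnitalStarSubalgebra.le_topologicalClosure _
    (NonUnitalStarAlgebra.subset_adjoin ℂ S (Set.mem_insert _ _)))

/-- A masa contains every element commuting with it. -/
theorem IsMasa.mem_of_comm (hA : IsMasa A) {x : B} (hx : ∀ a ∈ A, x * a = a * x) : x ∈ A := by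
  have hxs : ∀ a ∈ A, star x * a = a * star x := fun a ha => by
    have := congrArg star (hx _ (star_mem ha))
    simp only [star_mul, star_star] at this
    exact this.symm
  rw [← realPart_add_I_smul_imaginaryPart x]
  refine add_mem (hA.mem_of_selfAdjoint (realPart x).2.star_eq fun a ha => ?_)
    (SMulMemClass.smul_mem _ (hA.mem_of_selfAdjoint (imaginaryPart x).2.star_eq fun a ha => ?_))
  · simp only [realPart_apply_coe, smul_mul_assoc, mul_smul_comm, add_mul, mul_add, hx a ha,
      hxs a ha]
  · simp only [imaginaryPart_apply_coe, smul_mul_assoc, mul_smul_comm, sub_mul, mul_sub, hx a ha,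
      hxs a ha]

/-- Maximality turns commutation with `A` into membership, so characters of `A` can be evaluated at
`n n⋆` and `n⋆ n`. -/
theorem IsMasa.mul_star_mem [IsClosed (A : Set B)] (hA : IsMasa A) {n : B}
    (hn : IsNormaliser A n) : n * star n ∈ A :=
  hA.mem_of_comm fun _ ha => hn.mul_star_comm hA.comm ha

theorem IsMasa.star_mul_mem [IsClosed (A : Set B)] (hA : IsMasa A) {n : B}
    (hn : IsNormaliser A n) : star n * n ∈ A := by
  simpa using hA.mul_star_mem hn.adjoint

end Normaliser

/-! ### Characters of commutative C⋆-algebras -/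

section Character

variable {A : Type*} [NonUnitalCStarAlgebra A]

/-- Characters of a commutative C⋆-algebra separate its elements from zero. -/
theorem exists_character_ne_zero (hA : ∀ x y : A, x * y = y * x) {q : A} (hq : q ≠ 0) :
    ∃ χ : A →⋆ₙₐ[ℂ] ℂ, χ q ≠ 0 := by
  let _ : NonUnitalCommCStarAlgebra A := { ‹NonUnitalCStarAlgebra A› with mul_comm := hA }
  have hq' : (q : Unitization ℂ A) ≠ 0 := fun h => hq (Unitization.inr_injective h)
  have h1 : WeakDual.gelfandTransform ℂ (Unitization ℂ A) q ≠ 0 := fun h =>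
    hq' ((gelfandTransform_isometry (Unitization ℂ A)).injective (h.trans (map_zero _).symm))
  obtain ⟨φ, hφ⟩ : ∃ φ, WeakDual.gelfandTransform ℂ (Unitization ℂ A) q φ ≠ 0 := by
    by_contra! h
    exact h1 (ContinuousMap.ext h)
  exact ⟨(φ : Unitization ℂ A →⋆ₙₐ[ℂ] ℂ).comp (Unitization.inrNonUnitalStarAlgHom ℂ A), hφ⟩

open scoped ComplexOrder in
/-- Distinct characters can be separated by orthogonal elements. -/
theorem exists_mul_eq_zero_of_ne {χ₁ χ₂ : A →⋆ₙₐ[ℂ] ℂ} {e₁ e₂ f : A} (he₁ : χ₁ e₁ ≠ 0)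
    (he₂ : χ₂ e₂ ≠ 0) (hf : χ₁ f ≠ χ₂ f) : ∃ u v : A, u * v = 0 ∧ χ₁ u ≠ 0 ∧ χ₂ v ≠ 0 := by
  let _ : PartialOrder A := CStarAlgebra.spectralOrder A
  have : StarOrderedRing A := CStarAlgebra.spectralOrderedRing A
  -- This stands for `(f - χ₂ f) e₁`; the factor `e₁` replaces the possibly missing unit.
  set a := f * e₁ - χ₂ f • e₁ with ha
  set b := f * e₂ - χ₁ f • e₂ with hb
  have ha₁ : χ₁ a ≠ 0 := by
    rw [ha, map_sub, map_mul, map_smul, smul_eq_mul, ← sub_mul]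
    exact mul_ne_zero (sub_ne_zero.2 hf) he₁
  have ha₂ : χ₂ a = 0 := by
    rw [ha, map_sub, map_mul, map_smul, smul_eq_mul, sub_self]
  have hb₂ : χ₂ b ≠ 0 := by
    rw [hb, map_sub, map_mul, map_smul, smul_eq_mul, ← sub_mul]
    exact mul_ne_zero (sub_ne_zero.2 hf.symm) he₂
  have hb₁ : χ₁ b = 0 := by
    rw [hb, map_sub, map_mul, map_smul, smul_eq_mul, sub_self]
  -- Positive at `χ₁` and negative at `χ₂`, so its positive and negative parts are the required
  -- orthogonal pair.
  set h := star a * a - star b * b with hh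
  have hsa : IsSelfAdjoint h := (IsSelfAdjoint.star_mul_self a).sub (IsSelfAdjoint.star_mul_self b)
  have hdec : h⁺ - h⁻ = h := CFC.posPart_sub_negPart h hsa
  have hpos : ∀ (χ : A →⋆ₙₐ[ℂ] ℂ) (x : A), 0 ≤ x → 0 ≤ χ x := fun χ x hx => by
    obtain ⟨s, rfl⟩ := CStarAlgebra.nonneg_iff_eq_star_mul_self.1 hx
    rw [map_mul, map_star]
    exact star_mul_self_nonneg _
  have hpos' : ∀ z : ℂ, z ≠ 0 → 0 < star z * z := fun z hz =>
    lt_of_le_of_ne (star_mul_self_nonneg z) (mul_ne_zero (star_ne_zero.2 hz) hz).symm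
  have h₁ : 0 < χ₁ h := by
    rw [hh, map_sub, map_mul, map_mul, map_star, map_star, hb₁, mul_zero, sub_zero]
    exact hpos' _ ha₁
  have h₂ : χ₂ h < 0 := by
    rw [hh, map_sub, map_mul, map_mul, map_star, map_star, ha₂, mul_zero, zero_sub, neg_lt_zero]
    exact hpos' _ hb₂
  refine ⟨h⁺, h⁻, CFC.posPart_mul_negPart h, fun h0 => ?_, fun h0 => ?_⟩
  · rw [← hdec, map_sub, h0, zero_sub] at h₁
    exact absurd (hpos χ₁ _ (CFC.negPart_nonneg h)) (neg_pos.1 h₁).not_ge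
  · rw [← hdec, map_sub, h0, sub_zero] at h₂
    exact absurd (hpos χ₂ _ (CFC.posPart_nonneg h)) h₂.not_ge

end Character

/-! ### Compressing elements of `B` into the masa `A` -/

section Compression

variable {B : Type*} [NonUnitalCStarAlgebra B] {A : NonUnitalStarSubalgebra ℂ B}

/-- The map `a ↦ n⋆ a n` on `A`, for a normaliser `n`. -/
def IsNormaliser.conj {n : B} (hn : IsNormaliser A n) (a : A) : A :=
  ⟨star n * a * n, (hn a a.2).1⟩

theorem IsNormaliser.coe_conj {n : B} (hn : IsNormaliser A n) (a : A) :
    (hn.conj a : B) = star n * a * n := rfl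

theorem IsNormaliser.conj_star {n : B} (hn : IsNormaliser A n) (a : A) :
    hn.conj (star a) = star (hn.conj a) :=
  Subtype.ext <| by simp [IsNormaliser.coe_conj, mul_assoc]

variable [IsClosed (A : Set B)]

/-- Since `n n⋆` commutes with `A`, conjugation by `n` is multiplicative up to the factor `n⋆ n`.
Dividing by its value under a character gives `conjCharacter`. -/
theorem IsMasa.mul_conj_mul (hA : IsMasa A) {n : B} (hn : IsNormaliser A n) (a b : A) :
    ⟨star n * n, hA.star_mul_mem hn⟩ * hn.conj (a * b) = hn.conj a * hn.conj b :=
  Subtype.ext <| by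
    have h1 := hn.mul_star_comm hA.comm a.2
    simp only [NonUnitalStarSubalgebra.coe_mul, IsNormaliser.coe_conj]
    calc star n * n * (star n * (a * b : B) * n) = star n * (n * star n * a) * b * n := by
          noncomm_ring
      _ = star n * a * n * (star n * b * n) := by rw [h1]; noncomm_ring

/-- The character `a ↦ χ (n⋆ a n) / χ (n⋆ n)`. -/
def IsMasa.conjCharacter (hA : IsMasa A) {n : B} (hn : IsNormaliser A n) (χ : A →⋆ₙₐ[ℂ] ℂ)
    (hχ : χ ⟨star n * n, hA.star_mul_mem hn⟩ ≠ 0) : A →⋆ₙₐ[ℂ] ℂ where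
  toFun a := (χ ⟨star n * n, hA.star_mul_mem hn⟩)⁻¹ * χ (hn.conj a)
  map_smul' c a := by
    have : hn.conj (c • a) = c • hn.conj a :=
      Subtype.ext <| by simp [IsNormaliser.coe_conj, mul_smul_comm, smul_mul_assoc]
    rw [this, map_smul, smul_eq_mul, MonoidHom.id_apply, smul_eq_mul]
    ring
  map_zero' := by
    have : hn.conj 0 = 0 := Subtype.ext <| by simp [IsNormaliser.coe_conj]
    rw [this, map_zero, mul_zero]
  map_add' a b := by
    have : hn.conj (a + b) = hn.conj a + hn.conj b :=
      Subtype.ext <| by simp [IsNormaliser.coe_conj, mul_add, add_mul]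
    rw [this, map_add, mul_add]
  map_mul' a b := by
    have h2 := congrArg χ (hA.mul_conj_mul hn a b)
    rw [map_mul, map_mul] at h2
    field_simp
    rw [h2]
  map_star' a := by
    have h2 : star (⟨star n * n, hA.star_mul_mem hn⟩ : A) = ⟨star n * n, hA.star_mul_mem hn⟩ :=
      Subtype.ext <| by simp
    have h3 := map_star χ ⟨star n * n, hA.star_mul_mem hn⟩
    rw [h2] at h3
    rw [hn.conj_star, map_star, star_mul', star_inv₀, ← h3]

/-- For a normaliser `n` of a masa `A`, every nonzero principal ideal of `A` contains a nonzero
element compressing `n` into `A`. -/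
theorem IsMasa.exists_compression_normaliser (hA : IsMasa A) {n : B} (hn : IsNormaliser A n)
    {d : B} (hd : d ∈ A) (hd0 : d ≠ 0) :
    ∃ g ∈ A, d * g ≠ 0 ∧ d * g * n * (d * g) ∈ A := by
  by_cases hdn : d * n * d ∈ A
  · refine ⟨star d, star_mem hd, ?_, ?_⟩
    · rwa [Ne, CStarRing.mul_star_self_eq_zero_iff]
    · have h1 : d * star d * n * (d * star d) = star d * (d * n * d) * star d := by
        rw [hA.comm d hd _ (star_mem hd)]
        nth_rw 2 [← hA.comm d hd _ (star_mem hd)]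
        noncomm_ring
      rw [h1]
      exact mul_mem (mul_mem (star_mem hd) hdn) (star_mem hd)
  obtain ⟨f, hf, hfd⟩ : ∃ f ∈ A, d * n * d * f ≠ f * (d * n * d) := by
    by_contra! h
    exact hdn (hA.mem_of_comm h)
  have hy0 : (f * n - n * f) * d ≠ 0 := fun h => by
    apply hfd
    have h1 := congrArg (d * ·) h
    simp only [mul_zero, sub_mul, mul_sub, sub_eq_zero] at h1
    calc d * n * d * f = d * (n * (d * f)) := by noncomm_ring
      _ = d * (n * f * d) := by rw [hA.comm d hd f hf]; noncomm_ring
      _ = d * f * (n * d) := by rw [← h1]; noncomm_ring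
      _ = f * (d * n * d) := by rw [hA.comm d hd f hf]; noncomm_ring
  let D : A := ⟨d, hd⟩
  let F : A := ⟨f, hf⟩
  let k : A := ⟨star n * n, hA.star_mul_mem hn⟩
  -- The expansion of `y⋆ y` for `y = (f n - n f) d`, written in elements of `A` so that characters
  -- apply.
  let q : A := star D * (hn.conj (star F * F) - hn.conj (star F) * F - star F * hn.conj F
    + star F * k * F) * D
  have hq : (q : B) = star ((f * n - n * f) * d) * ((f * n - n * f) * d) := by
    simp only [q, D, F, k, IsNormaliser.coe_conj, star_mul, star_sub,
      NonUnitalStarSubalgebra.coe_mul, NonUnitalStarSubalgebra.coe_add,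
      NonUnitalStarSubalgebra.coe_sub, StarMemClass.coe_star]
    noncomm_ring
  have hq0 : q ≠ 0 := fun h => hy0 <| (CStarRing.star_mul_self_eq_zero_iff _).1 <| by
    rw [← hq, h]; rfl
  obtain ⟨χ, hχ⟩ := exists_character_ne_zero (fun x y : A => Subtype.ext (hA.comm x x.2 y y.2)) hq0
  have hk0 : χ k ≠ 0 := fun h => hχ <| by
    -- A Cauchy–Schwarz argument: `|χ (n⋆ a n)|² = χ (n⋆ n) χ (n⋆ a⋆ a n)`.
    have h1 : ∀ a, χ (hn.conj a) = 0 := fun a => by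
      have h2 := congrArg χ (hA.mul_conj_mul hn (star a) a)
      rw [map_mul, map_mul, h, zero_mul, hn.conj_star, map_star] at h2
      exact (CStarRing.star_mul_self_eq_zero_iff _).1 h2.symm
    simp only [q, map_mul, map_add, map_sub, h1, h]
    simp
  have hχd : χ D ≠ 0 := fun h => hχ <| by simp only [q, map_mul, h, mul_zero]
  let ψ := hA.conjCharacter hn χ hk0
  have hψ : ∀ a, χ (hn.conj a) = χ k * ψ a := fun a => (mul_inv_cancel_left₀ hk0 _).symm
  -- In terms of `ψ`, `χ q = |χ d|² χ (n⋆ n) |χ f - ψ f|²`.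
  have hne : χ F ≠ ψ F := fun h => hχ <| by
    simp only [q, map_mul, map_add, map_sub, hψ, map_star, h]
    ring
  -- Without a unit, separating characters needs an element on which `ψ` is nonzero; `ψ (n n⋆) = χ
  -- (n⋆ n)`.
  have hψ0 : ψ ⟨n * star n, hA.mul_star_mem hn⟩ ≠ 0 := fun h => by
    have h1 : hn.conj ⟨n * star n, hA.mul_star_mem hn⟩ = k * k := Subtype.ext <| by
      simp [IsNormaliser.coe_conj, k, mul_assoc]
    have h2 := hψ ⟨n * star n, hA.mul_star_mem hn⟩
    rw [h, h1, map_mul, mul_zero] at h2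
    exact hk0 (mul_self_eq_zero.1 h2)
  obtain ⟨u, v, huv, hu, hv⟩ := exists_mul_eq_zero_of_ne hχd hψ0 hne
  let g : A := u * hn.conj v
  refine ⟨g, g.2, fun h => ?_, ?_⟩
  · have h1 : D * g = 0 := Subtype.ext h
    have h2 := congrArg χ h1
    rw [map_mul, map_mul, hψ, map_zero] at h2
    exact mul_ne_zero hχd (mul_ne_zero hu (mul_ne_zero hk0 hv)) h2
  · have h0 : d * g * n * (d * g) = 0 := by
      -- Moving `n n⋆` past `u` exposes the product `u v = 0`.
      have hnv : (u : B) * n * (star n * v * n) = 0 := by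
        have h1 := hn.mul_star_comm hA.comm u.2
        have h2 : (u : B) * v = 0 := congrArg Subtype.val huv
        calc (u : B) * n * (star n * v * n) = u * (n * star n) * v * n := by noncomm_ring
          _ = n * star n * (u * v) * n := by rw [← h1]; noncomm_ring
          _ = 0 := by rw [h2]; simp
      have hg1 : d * g = d * (hn.conj v * u : A) := by
        rw [show hn.conj v * u = g from Subtype.ext (hA.comm _ (hn.conj v).2 _ u.2)]
      have hg2 : d * g = (hn.conj v : B) * (d * u) := by
        rw [hg1, NonUnitalStarSubalgebra.coe_mul, ← mul_assoc,
          hA.comm d hd _ (hn.conj v).2, mul_assoc]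
      calc d * g * n * (d * g) = d * (hn.conj v * u : A) * n * ((hn.conj v : B) * (d * u)) := by
            rw [← hg1, ← hg2]
        _ = d * hn.conj v * (u * n * (star n * v * n)) * (d * u) := by
            simp only [NonUnitalStarSubalgebra.coe_mul, IsNormaliser.coe_conj]
            noncomm_ring
        _ = 0 := by rw [hnv]; simp
    rw [h0]
    exact zero_mem A

/-- Every nonzero principal ideal of a masa contains a nonzero element compressing a given finite
linear combination of normalisers into the masa. -/
theorem IsMasa.exists_compression (hA : IsMasa A) {s : B}
    (hs : s ∈ Submodule.span ℂ {n : B | IsNormaliser A n}) :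
    ∀ d ∈ A, d ≠ 0 → ∃ g ∈ A, d * g ≠ 0 ∧ d * g * s * (d * g) ∈ A := by
  induction hs using Submodule.span_induction with
  | mem n hn => exact fun d hd hd0 => hA.exists_compression_normaliser hn hd hd0
  | zero =>
    refine fun d hd hd0 => ⟨star d, star_mem hd, ?_, ?_⟩
    · rwa [Ne, CStarRing.mul_star_self_eq_zero_iff]
    · simp
  | add s t _ _ ihs iht =>
    intro d hd hd0
    obtain ⟨g, hg, hg0, hgs⟩ := ihs d hd hd0
    -- Compressing `t` inside the ideal already chosen for `s` is harmless: a further factor from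
    -- `A` keeps the compression of `s` in `A`.
    obtain ⟨h, hh, hh0, hht⟩ := iht (d * g) (mul_mem hd hg) hg0
    refine ⟨g * h, mul_mem hg hh, by rwa [← mul_assoc], ?_⟩
    rw [← mul_assoc d g h, mul_add, add_mul]
    refine add_mem ?_ hht
    have : d * g * h * s * (d * g * h) = h * (d * g * s * (d * g)) * h := by
      nth_rw 1 [hA.comm _ (mul_mem hd hg) h hh]
      noncomm_ring
    rw [this]
    exact mul_mem (mul_mem hh hgs) hh
  | smul c s _ ih =>
    intro d hd hd0
    obtain ⟨g, hg, hg0, hgs⟩ := ih d hd hd0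
    refine ⟨g, hg, hg0, ?_⟩
    rw [mul_smul_comm, smul_mul_assoc]
    exact SMulMemClass.smul_mem c hgs

end Compression

/-! ### The canonical embedding into the local multiplier algebra -/

theorem AlgLocalMultiplier.of_res {A : Type*} [NonUnitalCStarAlgebra A] {I J : EssentialIdeal A}
    (h : I ≤ J) (m : I.Mult) :
    AlgLocalMultiplier.of J (EssentialIdeal.res I J h m) = AlgLocalMultiplier.of I m :=
  (DirectLimit.eq_of_le (f := EssentialIdeal.res) ⟨I, m⟩ J h).symm

namespace LocalMultiplier

variable {A : Type*} [NonUnitalCStarAlgebra A]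

theorem ofMultiplier_res {I J : EssentialIdeal A} (h : I ≤ J) (m : I.Mult) :
    ofMultiplier J (EssentialIdeal.res I J h m) = ofMultiplier I m :=
  congrArg ofAlg (AlgLocalMultiplier.of_res h m)

theorem ofMultiplier_mul (I : EssentialIdeal A) (m n : I.Mult) :
    ofMultiplier I (m * n) = ofMultiplier I m * ofMultiplier I n := by
  rw [ofMultiplier, ofMultiplier, ofMultiplier, ← ofAlg_mul, AlgLocalMultiplier.of_mul]

theorem norm_ofMultiplier (I : EssentialIdeal A) (m : I.Mult) : ‖ofMultiplier I m‖ = ‖m‖ := by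
  rw [ofMultiplier, norm_ofAlg, AlgLocalMultiplier.norm_of]

theorem ofElem_eq_ofMultiplier (I : EssentialIdeal A) (x : I.ideal) :
    ofElem (x : A) = ofMultiplier I (DoubleCentralizer.coe ℂ x) := by
  rw [ofElem, ← ofMultiplier_res (J := I) (fun y _ => ClosedIdeal.mem_whole y)]
  rfl

theorem ofElem_mul (a b : A) : ofElem (a * b) = ofElem a * ofElem b := by
  rw [ofElem, ofElem, ofElem, ← ofMultiplier_mul]
  congr 1
  exact map_mul (DoubleCentralizer.coeHom (𝕜 := ℂ) (A := ClosedIdeal.whole A))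
    ⟨a, ClosedIdeal.mem_whole a⟩ ⟨b, ClosedIdeal.mem_whole b⟩

theorem ofElem_star (a : A) : ofElem (star a) = star (ofElem a) := by
  rw [ofElem, ofElem, ofMultiplier, ofMultiplier, ← ofAlg_star, AlgLocalMultiplier.of_star]
  congr 2
  exact map_star (DoubleCentralizer.coeHom (𝕜 := ℂ) (A := ClosedIdeal.whole A))
    ⟨a, ClosedIdeal.mem_whole a⟩

theorem norm_ofElem (a : A) : ‖ofElem a‖ = ‖a‖ := by
  rw [ofElem, norm_ofMultiplier, ← DoubleCentralizer.norm_fst, DoubleCentralizer.coe_fst,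
    ContinuousLinearMap.opNorm_mul_apply]
  rfl

theorem ofElem_add (a b : A) : ofElem (a + b) = ofElem a + ofElem b := by
  rw [ofElem, ofElem, ofElem, ofMultiplier, ofMultiplier, ofMultiplier, ← ofAlg_add,
    AlgLocalMultiplier.of_add]
  congr 2
  exact map_add (DoubleCentralizer.coeHom (𝕜 := ℂ) (A := ClosedIdeal.whole A))
    ⟨a, ClosedIdeal.mem_whole a⟩ ⟨b, ClosedIdeal.mem_whole b⟩

theorem ofElem_smul (c : ℂ) (a : A) : ofElem (c • a) = c • ofElem a := by
  rw [ofElem, ofElem, ofMultiplier, ofMultiplier, ← ofAlg_smul, AlgLocalMultiplier.of_smul]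
  congr 2
  exact map_smul (DoubleCentralizer.coeHom (𝕜 := ℂ) (A := ClosedIdeal.whole A)) c
    ⟨a, ClosedIdeal.mem_whole a⟩

/-- The canonical embedding as a linear isometry. -/
def ofElemLI : A →ₗᵢ[ℂ] LocalMultiplier A where
  toFun := ofElem
  map_add' := ofElem_add
  map_smul' := ofElem_smul
  norm_map' := norm_ofElem

theorem continuous_ofElem : Continuous (ofElem (A := A)) := ofElemLI.continuous

theorem ofElem_zero : ofElem (0 : A) = 0 := by
  rw [← norm_eq_zero, norm_ofElem, norm_zero]

/-- Products with elements of an essential ideal return to `A`, so an element of `M_loc(A)` can be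
identified by its action there. -/
theorem ofMultiplier_mul_ofElem (I : EssentialIdeal A) (m : I.Mult) (x : I.ideal) :
    ofMultiplier I m * ofElem (x : A) = ofElem (m.fst x : A) := by
  rw [ofElem_eq_ofMultiplier, ofElem_eq_ofMultiplier, ← ofMultiplier_mul]
  congr 1
  refine DoubleCentralizer.ext _ _ _ _ (Prod.ext ?_ ?_)
  · ext1 y
    exact ClosedIdeal.fst_mul m x y
  · ext1 y
    exact m.central y x

/-- An element of the local multiplier algebra that annihilates an essential ideal is zero. -/
theorem eq_zero_of_mul_ofElem {I : ClosedIdeal A} (hI : I.IsEssential) {y : LocalMultiplier A}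
    (h : ∀ x ∈ I, y * ofElem x = 0) : y = 0 := by
  rw [← norm_le_zero_iff]
  refine le_of_forall_pos_le_add fun ε hε => ?_
  obtain ⟨z, hz⟩ := denseRange_ofAlg.exists_dist_lt y (half_pos hε)
  obtain ⟨J, m, rfl⟩ := AlgLocalMultiplier.exists_of z
  -- Restriction to `K` preserves the norm of the approximating multiplier, and on `K` it acts as
  -- minus the approximation error because `y` vanishes there.
  let K : EssentialIdeal A := ⟨J.ideal.inter I, J.essential.inter hI⟩
  have hJK : J ≤ K := fun x hx => hx.1
  set m' := EssentialIdeal.res J K hJK m with hm'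
  have hz' : ‖y - ofMultiplier K m'‖ < ε / 2 := by
    rw [hm', ofMultiplier_res, ← dist_eq_norm]
    exact hz
  have hm : ‖ofMultiplier K m'‖ ≤ ε / 2 := by
    rw [norm_ofMultiplier, ← DoubleCentralizer.norm_fst]
    refine ContinuousLinearMap.opNorm_le_bound _ (half_pos hε).le fun x => ?_
    have h1 : (y - ofMultiplier K m') * ofElem (x : A) = -ofElem (m'.fst x : A) := by
      rw [sub_mul, h x x.2.2, zero_sub, ofMultiplier_mul_ofElem]
    calc ‖m'.fst x‖ = ‖ofElem (m'.fst x : A)‖ := (norm_ofElem (m'.fst x : A)).symm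
      _ = ‖(y - ofMultiplier K m') * ofElem (x : A)‖ := by rw [h1, norm_neg]
      _ ≤ ‖y - ofMultiplier K m'‖ * ‖ofElem (x : A)‖ := norm_mul_le _ _
      _ ≤ ε / 2 * ‖x‖ := by
          rw [norm_ofElem]
          exact mul_le_mul_of_nonneg_right hz'.le (norm_nonneg _)
  calc ‖y‖ = ‖(y - ofMultiplier K m') + ofMultiplier K m'‖ := by rw [sub_add_cancel]
    _ ≤ ‖y - ofMultiplier K m'‖ + ‖ofMultiplier K m'‖ := norm_add_le _ _
    _ ≤ 0 + ε := by linarith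

/-- If `A` is commutative, it is central in its local multiplier algebra. -/
theorem mul_ofElem_comm (hA : ∀ x y : A, x * y = y * x) (y : LocalMultiplier A) (c : A) :
    y * ofElem c = ofElem c * y := by
  refine denseRange_ofAlg.induction_on (p := fun y => y * ofElem c = ofElem c * y) y
    (isClosed_eq (continuous_mul_const _) (continuous_const_mul _)) fun z => ?_
  obtain ⟨I, m, rfl⟩ := AlgLocalMultiplier.exists_of z
  change ofMultiplier I m * ofElem c = ofElem c * ofMultiplier I m
  rw [← sub_eq_zero]
  refine eq_zero_of_mul_ofElem I.essential fun x hx => ?_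
  have hcx : c * x ∈ I.ideal := I.ideal.mul_mem_left c hx
  -- The two sides agree after multiplication by any `w ∈ I`, since `(c x) w = x (c w)`; an element
  -- of `I` annihilating `I` is zero.
  have key : (m.fst ⟨c * x, hcx⟩ : A) = c * m.fst ⟨x, hx⟩ := by
    rw [← sub_eq_zero]
    set t := (m.fst ⟨c * x, hcx⟩ : A) - c * m.fst ⟨x, hx⟩ with ht
    have htI : t ∈ I.ideal := sub_mem (m.fst _).2 (I.ideal.mul_mem_left c (m.fst _).2)
    have h1 : ∀ w ∈ I.ideal, t * w = 0 := fun w hw => by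
      have h2 := congrArg Subtype.val (ClosedIdeal.fst_mul m ⟨c * x, hcx⟩ ⟨w, hw⟩)
      have h3 := congrArg Subtype.val (ClosedIdeal.fst_mul m ⟨x, hx⟩
        ⟨c * w, I.ideal.mul_mem_left c hw⟩)
      have h4 : (⟨c * x, hcx⟩ * ⟨w, hw⟩ : I.ideal)
          = ⟨x, hx⟩ * ⟨c * w, I.ideal.mul_mem_left c hw⟩ := Subtype.ext <| by
        change c * x * w = x * (c * w)
        rw [hA c x, mul_assoc]
      rw [h4] at h2
      have h5 := h2.symm.trans h3
      change (m.fst ⟨c * x, hcx⟩ : A) * w = (m.fst ⟨x, hx⟩ : A) * (c * w) at h5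
      rw [ht, sub_mul, h5, hA c (m.fst ⟨x, hx⟩ : A), mul_assoc, sub_self]
    exact (CStarRing.mul_star_self_eq_zero_iff t).1 (h1 _ (I.ideal.star_mem' htI))
  rw [sub_mul, mul_assoc, mul_assoc, ← ofElem_mul, ofMultiplier_mul_ofElem I m ⟨x, hx⟩,
    ofMultiplier_mul_ofElem I m ⟨c * x, hcx⟩, key, ofElem_mul, sub_self]

/-- If `A` is commutative and `y` in its local multiplier algebra is compressed to zero by a
nonzero element of every nonzero principal ideal of `A`, then `y = 0`. -/
theorem eq_zero_of_compression (hA : ∀ x y : A, x * y = y * x) {y : LocalMultiplier A}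
    (h : ∀ d : A, d ≠ 0 → ∃ g : A, d * g ≠ 0 ∧ ofElem (d * g) * y * ofElem (d * g) = 0) :
    y = 0 := by
  let I : ClosedIdeal A :=
    { carrier := {a | y * ofElem a = 0}
      add_mem' := fun {a b} ha hb => by
        change y * ofElem (a + b) = 0
        rw [ofElem_add, mul_add, ha, hb, add_zero]
      zero_mem' := by
        change y * ofElem 0 = 0
        rw [ofElem_zero, mul_zero]
      smul_mem' := fun c a ha => by
        change y * ofElem (c • a) = 0
        rw [ofElem_smul, mul_smul_comm, ha, smul_zero]
      isClosed' := isClosed_eq (continuous_ofElem.const_mul y) continuous_const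
      mul_mem_left' := fun a x hx => by
        change y * ofElem (a * x) = 0
        rw [hA, ofElem_mul, ← mul_assoc, hx, zero_mul]
      mul_mem_right' := fun a x hx => by
        change y * ofElem (x * a) = 0
        rw [ofElem_mul, ← mul_assoc, hx, zero_mul] }
  refine eq_zero_of_mul_ofElem (I := I) (fun d hd => ?_) fun x hx => hx
  by_contra hd0
  obtain ⟨g, hg0, hg⟩ := h d hd0
  -- With `c = d g`, centrality gives `y c² = c y c = 0`. Thus `c² ∈ I ∩ I^⊥ = 0`, and `c = 0`
  -- because `c` is normal.
  have h1 : d * g * (d * g) ∈ I := by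
    change y * ofElem (d * g * (d * g)) = 0
    rw [ofElem_mul, ← mul_assoc, mul_ofElem_comm hA y, hg]
  have h2 : d * g * (d * g) ∈ I.perp := I.perp.mul_mem_right _ (I.perp.mul_mem_right g hd)
  have h3 : d * g * (d * g) = 0 :=
    (CStarRing.mul_star_self_eq_zero_iff _).1 (h2 _ (I.star_mem' h1))
  refine hg0 ((CStarRing.star_mul_self_eq_zero_iff _).1 ?_)
  rw [← CStarRing.star_mul_self_eq_zero_iff (star (d * g) * (d * g)), star_mul, star_star,
    mul_assoc, ← mul_assoc (d * g), hA (d * g) (star (d * g)), mul_assoc (star (d * g)), h3,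
    mul_zero, mul_zero]

end LocalMultiplier

/-! ### The bimodule property of local expectations -/

section Gram

variable {B M : Type*} [NonUnitalCStarAlgebra B] [PartialOrder B] [StarOrderedRing B]
  [NonUnitalCStarAlgebra M] [PartialOrder M] [StarOrderedRing M]

theorem exists_eq_star_mul_self_of_nonneg {p : M} (hp : 0 ≤ p) : ∃ s, p = star s * s :=
  CStarAlgebra.nonneg_iff_eq_star_mul_self.1 hp

/-- If the vector `x - y a` has length zero for the `M`-valued inner product `⟨x, y⟩ = E (x⋆ y)` of
a completely positive map `E`, then it is orthogonal to all of `B`. -/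
theorem CompletelyPositiveMap.map_star_mul_of_gram (E : CompletelyPositiveMap B M) {x y : B} {a : M}
    (h : E (star x * x) - E (star x * y) * a - star a * E (star y * x)
      + star a * E (star y * y) * a = 0) (z : B) :
    E (star x * z) = star a * E (star y * z) ∧ E (star z * x) = E (star z * y) * a := by
  let v : Fin 3 → B := ![x, y, z]
  -- With `v` as its only nonzero row, `X⋆ X` is the Gram matrix `(v i⋆ v j)`. A factorisation `N⋆
  -- N` of its image represents the `M`-valued inner products by columns of `N`.
  let X : CStarMatrix (Fin 3) (Fin 3) B := CStarMatrix.ofMatrix fun i j => if i = 0 then v j else 0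
  have hX0 : ∀ j, X 0 j = v j := fun j => rfl
  have hX1 : ∀ j, X 1 j = 0 := fun j => rfl
  have hX2 : ∀ j, X 2 j = 0 := fun j => rfl
  have hX : 0 ≤ (star X * X).map E := E.map_cstarMatrix_nonneg _ (star_mul_self_nonneg X)
  obtain ⟨N, hN⟩ := exists_eq_star_mul_self_of_nonneg hX
  have hent : ∀ i j, E (star (v i) * v j) = ∑ k, star (N k i) * N k j := fun i j => by
    have h1 := congrFun (congrFun hN i) j
    have h2 : (star X * X) i j = star (v i) * v j := by
      simp [CStarMatrix.mul_apply, CStarMatrix.star_apply, Fin.sum_univ_three, hX0, hX1, hX2]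
    have h3 : (star N * N) i j = ∑ k, star (N k i) * N k j := by
      simp [CStarMatrix.mul_apply, CStarMatrix.star_apply]
    rw [← h3, ← h1, ← h2]
    rfl
  let w : Fin 3 → M := fun k => N k 0 - N k 1 * a
  have hw : ∑ k, star (w k) * w k = 0 := by
    rw [← h]
    have e00 := hent 0 0
    have e01 := hent 0 1
    have e10 := hent 1 0
    have e11 := hent 1 1
    simp only [v, Matrix.cons_val_zero, Matrix.cons_val_one] at e00 e01 e10 e11
    rw [e00, e01, e10, e11]
    simp only [w, Finset.mul_sum, Finset.sum_mul, ← Finset.sum_sub_distrib,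
      ← Finset.sum_add_distrib]
    refine Finset.sum_congr rfl fun k _ => ?_
    rw [star_sub, star_mul]
    noncomm_ring
  have hw0 : ∀ k, N k 0 = N k 1 * a := fun k => by
    have := (Finset.sum_eq_zero_iff_of_nonneg fun k _ => star_mul_self_nonneg (w k)).1 hw k
      (Finset.mem_univ k)
    exact sub_eq_zero.1 ((CStarRing.star_mul_self_eq_zero_iff _).1 this)
  constructor
  · have e02 := hent 0 2
    have e12 := hent 1 2
    simp only [v, Matrix.cons_val_zero, Matrix.cons_val_one, Matrix.cons_val_two, Matrix.tail_cons,
      Matrix.head_cons] at e02 e12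
    rw [e02, e12, Finset.mul_sum]
    exact Finset.sum_congr rfl fun k _ => by rw [hw0, star_mul, mul_assoc]
  · have e20 := hent 2 0
    have e21 := hent 2 1
    simp only [v, Matrix.cons_val_zero, Matrix.cons_val_one, Matrix.cons_val_two, Matrix.tail_cons,
      Matrix.head_cons] at e20 e21
    rw [e20, e21, Finset.sum_mul]
    exact Finset.sum_congr rfl fun k _ => by rw [hw0, mul_assoc]

end Gram

/-! ### Aperiodicity of regular masa inclusions -/

section Aperiodic

variable {B : Type*} [NonUnitalCStarAlgebra B] [PartialOrder B] [StarOrderedRing B]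
  {A : NonUnitalStarSubalgebra ℂ B} [IsClosed (A : Set B)]

/-- If `a s a ∈ A` and `‖a‖ = 1`, the class of `a b a` equals that of `a (b - s) a`, so its norm is
at most `‖b - s‖`. The required `a` is a normalised `c⋆ c`, where `c = d g` compresses `s` and `d ∈
D`. -/
theorem IsMasa.isAperiodicInclusion (hA : IsMasa A) (hreg : IsRegularInclusion A) :
    IsAperiodicInclusion A := by
  intro ε hε D hD hD0 b
  obtain ⟨d, hdD, hd0⟩ : ∃ d ∈ D, d ≠ 0 := by
    by_contra! h
    exact hD0 (eq_bot_iff.2 fun x hx => by rw [h x hx]; exact zero_mem _)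
  obtain ⟨s, hs, hbs⟩ := Metric.dense_iff.1 hreg b ε hε
  obtain ⟨g, hg, hg0, hgs⟩ := hA.exists_compression hbs d (hD.le hdD) hd0
  set c := d * g with hc
  have hcA : c ∈ A := mul_mem (hD.le hdD) hg
  set a₀ := star c * c with ha₀
  have ha₀D : a₀ ∈ D := by
    -- Heredity applies because `c⋆ c = d⋆ (g⋆ g) d ≤ ‖g⋆ g‖ d⋆ d`.
    refine hD.mem_of_le _ (mul_mem (star_mem hcA) hcA) (‖star g * g‖ • (star d * d)) ?_
      (star_mul_self_nonneg c) ?_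
    · rw [← Complex.coe_smul]
      exact SMulMemClass.smul_mem _ (mul_mem (star_mem hdD) hdD)
    · have h1 : a₀ = star d * (star g * g) * d := by
        rw [ha₀, hc, hA.comm d (hD.le hdD) g hg, star_mul]
        noncomm_ring
      rw [h1]
      exact CStarAlgebra.star_left_conjugate_le_norm_smul (IsSelfAdjoint.star_mul_self g)
  have ha₀n : ‖a₀‖ ≠ 0 := by
    rw [ha₀, CStarRing.norm_star_mul_self]
    exact mul_self_ne_zero.2 (norm_ne_zero_iff.2 hg0)
  have ha₀s : a₀ * s * a₀ ∈ A := by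
    have h1 : a₀ * s * a₀ = star c * (c * s * c) * star c := by
      rw [ha₀]
      nth_rw 2 [hA.comm _ (star_mem hcA) c hcA]
      noncomm_ring
    rw [h1]
    exact mul_mem (mul_mem (star_mem hcA) hgs) (star_mem hcA)
  set a := ‖a₀‖⁻¹ • a₀ with ha
  have han : ‖a‖ = 1 := by
    rw [ha, norm_smul, norm_inv, norm_norm, inv_mul_cancel₀ ha₀n]
  refine ⟨a, ?_, smul_nonneg (by positivity) (star_mul_self_nonneg c), han, ?_⟩
  · rw [ha, ← Complex.coe_smul]
    exact SMulMemClass.smul_mem _ ha₀D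
  have has : a * s * a ∈ A := by
    rw [ha, smul_mul_assoc, smul_mul_assoc, mul_smul_comm, ← Complex.coe_smul, ← Complex.coe_smul]
    exact SMulMemClass.smul_mem _ (SMulMemClass.smul_mem _ ha₀s)
  have hq : (Submodule.Quotient.mk (a * b * a) : B ⧸ A.toNonUnitalSubalgebra.toSubmodule)
      = Submodule.Quotient.mk (a * (b - s) * a) := by
    rw [Submodule.Quotient.eq]
    have : a * b * a - a * (b - s) * a = a * s * a := by noncomm_ring
    rw [this]
    exact has
  rw [hq]
  calc _ ≤ ‖a * (b - s) * a‖ := Submodule.Quotient.norm_mk_le _ _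
    _ ≤ ‖a‖ * ‖b - s‖ * ‖a‖ := (norm_mul_le _ _).trans (by gcongr; exact norm_mul_le _ _)
    _ = ‖b - s‖ := by rw [han, one_mul, mul_one]
    _ < ε := by rw [← dist_eq_norm, dist_comm]; exact hs

end Aperiodic

/-! ### Local expectations -/

section LocalExpectation

open LocalMultiplier

variable {B : Type*} [NonUnitalCStarAlgebra B] {A : NonUnitalStarSubalgebra ℂ B}

theorem IsNormaliser.mul_left {n : B} (hn : IsNormaliser A n) {c : B} (hc : c ∈ A) :
    IsNormaliser A (c * n) := fun a ha => by
  have h1 := (hn _ (mul_mem (mul_mem (star_mem hc) ha) hc)).1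
  have h2 := mul_mem (mul_mem hc (hn a ha).2) (star_mem hc)
  simp only [star_mul, mul_assoc] at h1 h2 ⊢
  exact ⟨h1, h2⟩

variable [PartialOrder B] [StarOrderedRing B] [IsClosed (A : Set B)]
  {E F : CompletelyPositiveMap B (LocalMultiplier A)}

theorem IsLocalExpectation.continuous (hE : IsLocalExpectation A E) : Continuous E :=
  AddMonoidHomClass.continuous_of_bound E 1 fun b => by
    rw [one_mul]
    exact hE.contractive b

/-- The elements of `A` are in the multiplicative domain of a local expectation, up to elements
of `A` acting as local units. -/
theorem IsLocalExpectation.map_mul_mul (hE : IsLocalExpectation A E) (a e : A) (z : B) :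
    E (star ((e : B) * a) * z) = star (ofElem a) * E (star (e : B) * z) ∧
      E (star z * ((e : B) * a)) = E (star z * e) * ofElem a := by
  -- All four products in the Gram condition lie in `A`, where `E` is the multiplicative embedding,
  -- so the terms cancel.
  refine E.map_star_mul_of_gram ?_ z
  have h1 := hE.apply_coe (star (e * a) * (e * a))
  have h2 := hE.apply_coe (star (e * a) * e)
  have h3 := hE.apply_coe (star e * (e * a))
  have h4 := hE.apply_coe (star e * e)
  simp only [NonUnitalStarSubalgebra.coe_mul, StarMemClass.coe_star] at h1 h2 h3 h4
  rw [h1, h2, h3, h4]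
  simp only [ofElem_mul, ofElem_star, star_mul]
  noncomm_ring

/-- Since `n⋆ n ∈ A`, an approximate unit of `A` satisfies `n g → n`. It therefore supplies the
local units needed in `map_mul_mul`, which continuity of `E` removes in the limit. -/
theorem IsLocalExpectation.map_normaliser_mul (hA : IsMasa A) (hE : IsLocalExpectation A E)
    {n : B} (hn : IsNormaliser A n) (a : A) : E (n * a) = E n * ofElem a := by
  obtain ⟨l, hl0, hl, hlA⟩ := A.exists_approximateUnit
  have hl' : ∀ᶠ g in l, star g = g ∧ ‖g‖ ≤ 1 := hl.mono fun g hg => hg.2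
  have hln : Tendsto (fun g => n * g) l (𝓝 n) := by
    refine tendsto_mul_star_of_tendsto hl' (tendsto_mul_of_mul_star hl' (hlA _ ?_))
    rw [star_star]
    exact hA.star_mul_mem hn
  have h1 := (hE.continuous.tendsto _).comp (hln.mul_const (a : B))
  have h2 := ((hE.continuous.tendsto _).comp hln).mul_const (ofElem a)
  refine tendsto_nhds_unique_of_eventuallyEq h1 h2 ?_
  filter_upwards [hl] with g hg
  have := (hE.map_mul_mul a ⟨g, hg.1⟩ (star n)).2
  rw [star_star, ← mul_assoc] at this
  exact this

theorem IsLocalExpectation.map_mul_normaliser (hA : IsMasa A) (hE : IsLocalExpectation A E)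
    {n : B} (hn : IsNormaliser A n) (a : A) : E (a * n) = ofElem a * E n := by
  obtain ⟨l, hl0, hl, hlA⟩ := A.exists_approximateUnit
  have hl' : ∀ᶠ g in l, star g = g ∧ ‖g‖ ≤ 1 := hl.mono fun g hg => hg.2
  have hln : Tendsto (fun g => g * n) l (𝓝 n) :=
    tendsto_mul_of_mul_star hl' (hlA _ (hA.mul_star_mem hn))
  have h1 := (hE.continuous.tendsto _).comp (hln.const_mul (a : B))
  have h2 := ((hE.continuous.tendsto _).comp hln).const_mul (ofElem a)
  refine tendsto_nhds_unique_of_eventuallyEq h1 h2 ?_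
  filter_upwards [hl] with g hg
  have := (hE.map_mul_mul (star a) ⟨g, hg.1⟩ n).1
  rw [ofElem_star, star_star, star_mul, hg.2.1, StarMemClass.coe_star, star_star,
    mul_assoc] at this
  exact this

theorem IsLocalExpectation.map_compression (hA : IsMasa A) (hE : IsLocalExpectation A E)
    {n : B} (hn : IsNormaliser A n) (c : A) :
    E (c * n * c) = ofElem c * E n * ofElem c := by
  rw [hE.map_normaliser_mul hA (hn.mul_left c.2), hE.map_mul_normaliser hA hn]

/-- Local expectations for a regular masa inclusion are unique. -/
theorem IsLocalExpectation.unique (hA : IsMasa A) (hreg : IsRegularInclusion A)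
    (hE : IsLocalExpectation A E) (hF : IsLocalExpectation A F) : E = F := by
  have key : ∀ n, IsNormaliser A n → E n = F n := fun n hn => by
    rw [← sub_eq_zero]
    refine eq_zero_of_compression (fun x y => Subtype.ext (hA.comm x x.2 y y.2)) fun d hd0 => ?_
    obtain ⟨g, hg, hg0, hgn⟩ := hA.exists_compression_normaliser hn d.2
      (fun h => hd0 (Subtype.ext h))
    refine ⟨⟨g, hg⟩, fun h => hg0 (congrArg Subtype.val h), ?_⟩
    rw [mul_sub, sub_mul, ← hE.map_compression hA hn, ← hF.map_compression hA hn, sub_eq_zero]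
    exact (hE.apply_coe ⟨_, hgn⟩).trans (hF.apply_coe ⟨_, hgn⟩).symm
  refine DFunLike.coe_injective (Continuous.ext_on hreg hE.continuous hF.continuous fun s hs => ?_)
  induction hs using Submodule.span_induction with
  | mem n hn => exact key n hn
  | zero => rw [map_zero, map_zero]
  | add s t _ _ hs ht => rw [map_add, map_add, hs, ht]
  | smul c s _ hs => rw [map_smul, map_smul, hs]

end LocalExpectation

/-! ### Slices -/

section Slice

open LocalMultiplier

variable {B : Type*} [NonUnitalCStarAlgebra B] {A : NonUnitalStarSubalgebra ℂ B}
  [IsClosed (A : Set B)] {W : Submodule ℂ B}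

/-- For an approximate unit `e` of `W ∩ A`, `w x e = (w x)(e⋆)⋆` lies in `W W⋆ ⊆ A`. -/
theorem IsSlice.mul_mem_masa (hW : IsSlice A W) {w : B} (hw : w ∈ W) (x : hW.interIdeal) :
    w * (x : A) ∈ A := by
  let _ : PartialOrder hW.interIdeal := CStarAlgebra.spectralOrder hW.interIdeal
  have : StarOrderedRing hW.interIdeal := CStarAlgebra.spectralOrderedRing hW.interIdeal
  have hl := CStarAlgebra.increasingApproximateUnit hW.interIdeal
  have := hl.neBot
  have hc : Continuous fun y : hW.interIdeal => w * ((y : A) : B) :=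
    (continuous_subtype_val.comp continuous_subtype_val).const_mul w
  refine IsClosed.mem_of_tendsto ‹IsClosed (A : Set B)›
    ((hc.tendsto x).comp (hl.tendsto_mul_left x)) (.of_forall fun e => ?_)
  have h1 := hW.mul_star_mem _ (hW.mul_mem_right (x : A) (x : A).2 w hw) _
    (hW.interIdeal.star_mem' e.2)
  rw [StarMemClass.coe_star, star_star, mul_assoc] at h1
  exact h1

theorem IsSlice.masa_mul_mem (hW : IsSlice A W) {w : B} (hw : w ∈ W) (x : hW.interIdeal) :
    ((x : A) : B) * w ∈ A := by
  let _ : PartialOrder hW.interIdeal := CStarAlgebra.spectralOrder hW.interIdeal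
  have : StarOrderedRing hW.interIdeal := CStarAlgebra.spectralOrderedRing hW.interIdeal
  have hl := CStarAlgebra.increasingApproximateUnit hW.interIdeal
  have := hl.neBot
  have hc : Continuous fun y : hW.interIdeal => ((y : A) : B) * w :=
    (continuous_subtype_val.comp continuous_subtype_val).mul_const w
  refine IsClosed.mem_of_tendsto ‹IsClosed (A : Set B)›
    ((hc.tendsto x).comp (hl.tendsto_mul_right x)) (.of_forall fun e => ?_)
  have h1 := hW.star_mul_mem _ (hW.interIdeal.star_mem' e.2) _
    (hW.mul_mem_left (x : A) (x : A).2 w hw)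
  rw [StarMemClass.coe_star, star_star, ← mul_assoc] at h1
  exact h1

/-- An element `w` of a slice `W` acts on `W ∩ A` as a multiplier. -/
def IsSlice.multiplier (hW : IsSlice A W) {w : B} (hw : w ∈ W) :
    DoubleCentralizer ℂ hW.interIdeal where
  fst :=
    { toFun := fun x => ⟨⟨w * (x : A), hW.mul_mem_masa hw x⟩,
        hW.mul_mem_right (x : A) (x : A).2 w hw⟩
      map_add' := fun _ _ => Subtype.ext <| Subtype.ext <| mul_add w _ _
      map_smul' := fun c _ => Subtype.ext <| Subtype.ext <| mul_smul_comm c w _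
      cont := (((continuous_subtype_val.comp continuous_subtype_val).const_mul w).subtype_mk
        _).subtype_mk _ }
  snd :=
    { toFun := fun x => ⟨⟨(x : A) * w, hW.masa_mul_mem hw x⟩,
        hW.mul_mem_left (x : A) (x : A).2 w hw⟩
      map_add' := fun _ _ => Subtype.ext <| Subtype.ext <| add_mul _ _ w
      map_smul' := fun c _ => Subtype.ext <| Subtype.ext <| smul_mul_assoc c _ w
      cont := (((continuous_subtype_val.comp continuous_subtype_val).mul_const w).subtype_mk
        _).subtype_mk _ }
  central _ _ := Subtype.ext <| Subtype.ext <| mul_assoc _ _ _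

variable [PartialOrder B] [StarOrderedRing B] {E : CompletelyPositiveMap B (LocalMultiplier A)}

/-- A local expectation vanishes on `W (W ∩ A)^⊥` for a slice `W`. -/
theorem IsLocalExpectation.map_slice_mul_perp (hA : IsMasa A) (hE : IsLocalExpectation A E)
    (hW : IsSlice A W) {w : B} (hw : w ∈ W) {y : A} (hy : y ∈ hW.interIdeal.perp) :
    E (w * y) = 0 := by
  have hwy : w * y ∈ W := hW.mul_mem_right y y.2 w hw
  have hn := hW.isNormaliser _ hwy
  refine eq_zero_of_compression (fun x y => Subtype.ext (hA.comm x x.2 y y.2)) fun d hd0 => ?_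
  obtain ⟨g, hg, hg0, hgn⟩ := hA.exists_compression_normaliser hn d.2
    (fun h => hd0 (Subtype.ext h))
  refine ⟨⟨g, hg⟩, fun h => hg0 (congrArg Subtype.val h), ?_⟩
  rw [← hE.map_compression hA hn]
  let c : A := d * ⟨g, hg⟩
  let t : A := ⟨c * (w * y) * c, hgn⟩
  have ht : t ∈ hW.interIdeal := hW.mul_mem_right c c.2 _ (hW.mul_mem_left c c.2 _ hwy)
  -- Since `t ∈ W ∩ A`, also `c t⋆ ∈ W ∩ A`, which `y` annihilates; hence `t t⋆ = c w (y c t⋆) = 0`.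
  have ht0 : t = 0 := by
    rw [← CStarRing.mul_star_self_eq_zero_iff]
    have h1 : y * (c * star t) = 0 :=
      hy _ (hW.interIdeal.mul_mem_left c (hW.interIdeal.star_mem' ht))
    have h2 : (y : B) * (c * star (t : B)) = 0 := congrArg Subtype.val h1
    apply Subtype.ext
    calc (c : B) * (w * y) * c * star (t : B) = c * w * (y * (c * star (t : B))) := by
          simp only [mul_assoc]
      _ = 0 := by rw [h2, mul_zero]
  exact (hE.apply_coe t).trans (by rw [ht0, ofElem_zero])

/-- A local expectation maps an element `w` of a slice `W` to the multiplier of `W ∩ A` given by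
multiplication with `w`. -/
theorem IsLocalExpectation.map_slice (hA : IsMasa A) (hE : IsLocalExpectation A E)
    (hW : IsSlice A W) {w : B} (hw : w ∈ W) :
    E w = ofIdealMultiplier hW.interIdeal (hW.multiplier hw) := by
  rw [← sub_eq_zero]
  refine eq_zero_of_mul_ofElem hW.interIdeal.sumPerp_isEssential fun z hz => ?_
  let x := hW.interIdeal.proj ⟨z, hz⟩
  have hy : z - x ∈ hW.interIdeal.perp := hW.interIdeal.sub_proj_mem ⟨z, hz⟩
  have h1 : ofIdealMultiplier hW.interIdeal (hW.multiplier hw) * ofElem z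
      = ofElem ⟨w * (x : A), hW.mul_mem_masa hw x⟩ :=
    ofMultiplier_mul_ofElem ⟨_, hW.interIdeal.sumPerp_isEssential⟩ _ ⟨z, hz⟩
  -- Bilinearity moves `z` inside `E`. The `W ∩ A` component contributes `w x ∈ A`, and the
  -- annihilator component contributes zero.
  have h2 : E w * ofElem z = ofElem ⟨w * (x : A), hW.mul_mem_masa hw x⟩ := by
    rw [← hE.map_normaliser_mul hA (hW.isNormaliser w hw)]
    have h3 : w * (z : B) = w * ((x : A) : B) + w * ((z - x : A) : B) := by
      rw [← mul_add]
      congr 1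
      simp
    rw [h3, map_add, hE.map_slice_mul_perp hA hW hw hy, add_zero]
    exact hE.apply_coe ⟨w * (x : A), hW.mul_mem_masa hw x⟩
  rw [sub_mul, h1, h2, sub_self]

end Slice

end

theorem mainTheorem9 {B : Type*} [NonUnitalCStarAlgebra B] [PartialOrder B] [StarOrderedRing B]
    (A : NonUnitalStarSubalgebra ℂ B) [IsClosed (A : Set B)]
    (hmasa : IsMasa A) (hreg : IsRegularInclusion A) :
    IsAperiodicInclusion A ∧
    (∀ E F : CompletelyPositiveMap B (LocalMultiplier A),
      IsLocalExpectation A E → IsLocalExpectation A F → E = F) ∧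
    (∀ E : CompletelyPositiveMap B (LocalMultiplier A), IsLocalExpectation A E →
      ∀ (W : Submodule ℂ B) (hW : IsSlice A W), ∀ w ∈ W,
        ∃ m : DoubleCentralizer ℂ hW.interIdeal,
          E w = LocalMultiplier.ofIdealMultiplier hW.interIdeal m) :=
  ⟨hmasa.isAperiodicInclusion hreg, fun _ _ hE hF => hE.unique hmasa hreg hF,
    fun _ hE _ hW _ hw => ⟨hW.multiplier hw, hE.map_slice hmasa hW hw⟩⟩
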